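/- Let $m,n\ge 0$ be integers with $m+n\ge 1$ and let $a_1,\dots,a_m,b_1,\dots,b_n\in\mathbb R$. On a probability space consider the ARX system $$y_k+\sum_{i=1}^m a_i y_{k-i}=\sum_{j=1}^n b_j u_{k-j}+d_k,\qquad k\ge 1,$$ with $y_k=0$ for $k\le 0$ and $u_k=0$ for $k<0$. Put $\phi_k=[-y_{k-1},\dots,-y_{k-m},u_{k-1},\dots,u_{k-n}]^T$, and for a process $\{z_k\}$ write $\bar{\mathbb E}[\{z_k\}]=\lim_{K\to\infty}\frac1K\sum_{k=1}^K\mathbb E[z_k]$. A process $\{z_k\}$ (set to $0$ before its initial time) is called quasi-stationary if its entries are square integrable, $\mathbb E[z_k]$ and $\mathbb E[z_iz_j]$ are bounded uniformly in $k$ and in $i,j$, and $\bar{\mathbb E}[\{z_kz_{k-\tau}\}]$ exists for every $\tau\in\mathbb Z$. Assume the following. 1. There are a bounded deterministic sequence $\{r_k\}_{k\ge0}$, a sequence $\{e_k\}_{k\ge0}$ of independent random variables with mean zero, common variance $\delta_e^2$ and, for each positive integer $q$, $\sup_k\mathbb E|e_k|^q<\infty$, and real filter coefficients $f^{(j)}_i(k)$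 such that, almost surely for every $k\ge1$ (with $r_l=e_l=0$ for $l<0$), $$y_k=\sum_{i\ge1}f^{(1)}_i(k)r_{k-i}+\sum_{i\ge0}f^{(2)}_i(k)e_{k-i},\qquad u_k=\sum_{i\ge0}f^{(3)}_i(k)r_{k-i}+\sum_{i\ge0}f^{(4)}_i(k)e_{k-i}.$$ There is a sequence $\{f_i\}_{i\ge1}$ with $\sum_i|f_i|<\infty$ and $|f^{(j)}_i(k)|\le|f_i|$ for all $i\ge1$, $k\ge1$, $j=1,2,3,4$. Moreover $\{y_k\}_{k\ge1}$ and $\{u_k\}_{k\ge0}$ are quasi-stationary, $\bar{\mathbb E}[\{y_ku_{k-\tau}\}]$ exists for every $\tau\in\mathbb Z$, and $\bar{\mathbb E}[\{\phi_k\phi_k^T\}]$ exists and is positive definite. 2. $1+a_1z^{-1}+\dots+a_mz^{-m}\ne0$ for every $z\in\mathbb C$ with $|z|\ge1$. 3. $d_1,d_2,\dots$ are independent Gaussian random variables with mean zero and variance $\delta_d^2$. Let $P_0$ be a positive definite matrix, let $\hat\theta^{\rm RLS}_0,\hat\theta_0\in\mathbb R^{m+n}$, $\frac12<\alpha<1$,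 and let $\beta_k$ $(k\ge 1)$ be real numbers with $0<\underline\beta\le\beta_k\le\bar\beta<\infty$. Let $x_k\in\mathbb R^{m+n}$ be the unit vector whose $(k\bmod(m+n)+1)$-th entry is $1$. For $k\ge1$ define $$a^{*}_k=(1+\phi_k^TP_{k-1}\phi_k)^{-1},\qquad P_k=P_{k-1}-a^{*}_kP_{k-1}\phi_k\phi_k^TP_{k-1},$$ $$\hat\theta^{\rm RLS}_k=\hat\theta^{\rm RLS}_{k-1}+a^{*}_kP_{k-1}\phi_k\,(y_k-\phi_k^T\hat\theta^{\rm RLS}_{k-1}),$$ $$s_k=\begin{cases}1,& x_k^T\hat\theta^{\rm RLS}_k>x_k^T\hat\theta_{k-1},\\-1,&\text{otherwise,}\end{cases}\qquad \hat\theta_k=\hat\theta_{k-1}+\beta_kx_k\frac{s_k}{k^\alpha}.$$ Set $\omega_k=x_k^T\hat\theta_k-x_k^T\hat\theta^{\rm RLS}_{k+m+n}$ and $\rho=\bar\beta+2\underline\beta/3$. Then for every positive integer $p$, $$\mathbb P\Big(|\omega_k|>\frac{\rho}{k^\alpha}\Big)=O\Big(\frac1{k^p}\Big)\qquad(k\to\infty).$$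 -/

import Mathlib

open MeasureTheory ProbabilityTheory Filter Topology Matrix

namespace ArxOneBit

noncomputable section

/-! ### Signals

The output and the input are two-sided sequences `y u : ℤ → Ω → ℝ`, extended by zero to the times
before the start of the experiment. The parameter, regression and estimate vectors are elements of
`Fin (m + n) → ℝ`, with the `m` output coordinates first. -/

section Signals

variable {Ω : Type*} [MeasurableSpace Ω]

/-- `L` is the limit of the averaged expectations `(1 / K) ∑_{l = 1}^{K} E[x_l]`. -/
def HasTimeAvg (P : Measure Ω) (x : ℤ → Ω → ℝ) (L : ℝ) : Prop :=
  Tendsto (fun K : ℕ => (1 / (K : ℝ)) * ∑ l ∈ Finset.Icc 1 K, ∫ ω, x (l : ℤ) ω ∂P) atTop (𝓝 L)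

/-- Quasi-stationarity of a (zero-extended) process: square integrable, uniformly bounded means
and correlations, and the covariance function `R_τ = lim (1 / K) ∑_{k ≤ K} E[x_k x_{k-τ}]` exists
for every integer `τ`. -/
structure QuasiStationary (P : Measure Ω) (x : ℤ → Ω → ℝ) : Prop where
  memLp : ∀ k, MemLp (x k) 2 P
  bounded : ∃ C : ℝ, (∀ k, |∫ ω, x k ω ∂P| ≤ C) ∧ ∀ i j, |∫ ω, x i ω * x j ω ∂P| ≤ C
  covariance : ∀ τ : ℤ, ∃ R : ℝ, HasTimeAvg P (fun k ω => x k ω * x (k - τ) ω) R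

/-- The regression vector
`φ_k = [-y_{k-1}, …, -y_{k-m}, u_{k-1}, …, u_{k-n}]ᵀ` along one pair of sample paths. -/
def regressor (m n : ℕ) (y u : ℤ → ℝ) (k : ℤ) : Fin (m + n) → ℝ :=
  Fin.append (fun i : Fin m => -y (k - ((i : ℤ) + 1))) (fun j : Fin n => u (k - ((j : ℤ) + 1)))

/-- The system `A(q) y_k = B(q) u_k + d_k`, `k ≥ 1`, started at rest, where
`A(q) = 1 + a_1 q⁻¹ + … + a_m q⁻ᵐ` and `B(q) = b_1 q⁻¹ + … + b_n q⁻ⁿ`. The entry `a i` of the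
vector `a` is the coefficient `a_{i+1}`, and likewise for `b`. -/
structure IsArxSystem (P : Measure Ω) {m n : ℕ} (a : Fin m → ℝ) (b : Fin n → ℝ)
    (y u : ℤ → Ω → ℝ) (d : ℕ → Ω → ℝ) : Prop where
  output_zero : ∀ k ≤ 0, ∀ ω, y k ω = 0
  input_zero : ∀ k < 0, ∀ ω, u k ω = 0
  equation : ∀ k : ℕ, 1 ≤ k → ∀ᵐ ω ∂P,
    y k ω + ∑ i : Fin m, a i * y (k - ((i : ℤ) + 1)) ω
      = ∑ j : Fin n, b j * u (k - ((j : ℤ) + 1)) ω + d k ω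

/-- The sequence `e_0, e_1, …` consists of independent random variables with mean zero, common
variance `δ²`, and uniformly bounded moments of every order. -/
structure IsDrivingNoise (P : Measure Ω) (e : ℕ → Ω → ℝ) (δ : ℝ) : Prop where
  indep : iIndepFun e P
  memLp : ∀ (k q : ℕ), MemLp (e k) q P
  mean_zero : ∀ k, ∫ ω, e k ω ∂P = 0
  variance_eq : ∀ k, variance (e k) P = δ ^ 2
  moments : ∀ q : ℕ, ∃ C : ℝ, ∀ k, ∫ ω, |e k ω| ^ q ∂P ≤ C

/-- The standing assumption on the data: the output and the input are generated from a bounded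
deterministic sequence `r` and a driving noise `e` by a uniformly stable family of filters, are
jointly quasi-stationary, and the regression vector is persistently exciting.
`f j k i` is the coefficient of the `j`-th filter at time `k` and lag `i`. As `r` and `e` start at
time `0`, the sums over all lags stop at lag `k`. -/
structure DataAssumption (P : Measure Ω) (m n : ℕ) (y u : ℤ → Ω → ℝ) (r : ℕ → ℝ) (e : ℕ → Ω → ℝ)
    (δ : ℝ) (f : Fin 4 → ℕ → ℕ → ℝ) : Prop where
  bounded_r : ∃ C : ℝ, ∀ k, |r k| ≤ C
  noise : IsDrivingNoise P e δ
  output_eq : ∀ k : ℕ, 1 ≤ k → ∀ᵐ ω ∂P,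
    y k ω = ∑ i ∈ Finset.Icc 1 k, f 0 k i * r (k - i)
      + ∑ i ∈ Finset.Icc 0 k, f 1 k i * e (k - i) ω
  input_eq : ∀ k : ℕ, 1 ≤ k → ∀ᵐ ω ∂P,
    u k ω = ∑ i ∈ Finset.Icc 0 k, f 2 k i * r (k - i)
      + ∑ i ∈ Finset.Icc 0 k, f 3 k i * e (k - i) ω
  uniformly_stable : ∃ g : ℕ → ℝ, Summable (fun i => |g i|) ∧
    ∀ j, ∀ k ≥ 1, ∀ i ≥ 1, |f j k i| ≤ |g i|
  output_qs : QuasiStationary P y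
  input_qs : QuasiStationary P u
  cross_covariance : ∀ τ : ℤ, ∃ R : ℝ, HasTimeAvg P (fun k ω => y k ω * u (k - τ) ω) R
  persistent_excitation : ∃ M : Matrix (Fin (m + n)) (Fin (m + n)) ℝ,
    (∀ i j, HasTimeAvg P
      (fun k ω => regressor m n (fun t => y t ω) (fun t => u t ω) k i
        * regressor m n (fun t => y t ω) (fun t => u t ω) k j) (M i j)) ∧
    M.PosDef

/-- Stability of `A(q)`: `A(z) = 1 + a_1 z⁻¹ + … + a_m z⁻ᵐ` has no zero on or outside the unit
circle, i.e. the filter `1 / A(q)` has no pole there. -/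
def IsStable {m : ℕ} (a : Fin m → ℝ) : Prop :=
  ∀ z : ℂ, 1 ≤ ‖z‖ → 1 + ∑ i : Fin m, (a i : ℂ) * (z⁻¹) ^ ((i : ℕ) + 1) ≠ 0

/-- `d_1, d_2, …` are independent and Gaussian with mean zero and variance `v`. -/
structure IsGaussianNoise (P : Measure Ω) (d : ℕ → Ω → ℝ) (v : NNReal) : Prop where
  indep : iIndepFun (fun k : ℕ => d (k + 1)) P
  law : ∀ k ≥ 1, HasLaw (d k) (gaussianReal 0 v) P

end Signals

/-! ### The algorithm, along one pair of sample paths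

`y k` and `φ k` are the output and the regression vector at time `k`. -/

section Algorithm

variable {N : ℕ}

/-- `(1 + φᵀ Q φ)⁻¹`, which gives `a_k` for `Q = P_{k-1}` and `φ = φ_k`. -/
def rlsGain (Q : Matrix (Fin N) (Fin N) ℝ) (φ : Fin N → ℝ) : ℝ :=
  (1 + φ ⬝ᵥ (Q *ᵥ φ))⁻¹

/-- The matrices `P_k` of recursive least squares. -/
def rlsMatrix (P₀ : Matrix (Fin N) (Fin N) ℝ) (φ : ℕ → Fin N → ℝ) :
    ℕ → Matrix (Fin N) (Fin N) ℝ
  | 0 => P₀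
  | k + 1 =>
    rlsMatrix P₀ φ k - rlsGain (rlsMatrix P₀ φ k) (φ (k + 1)) •
      (rlsMatrix P₀ φ k * vecMulVec (φ (k + 1)) (φ (k + 1)) * rlsMatrix P₀ φ k)

/-- The local recursive least squares estimates `θ̂_k^RLS`. -/
def rlsEstimate (P₀ : Matrix (Fin N) (Fin N) ℝ) (θ₀ : Fin N → ℝ) (y : ℕ → ℝ)
    (φ : ℕ → Fin N → ℝ) : ℕ → Fin N → ℝ
  | 0 => θ₀
  | k + 1 =>
    rlsEstimate P₀ θ₀ y φ k +
      (rlsGain (rlsMatrix P₀ φ k) (φ (k + 1)) *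
        (y (k + 1) - φ (k + 1) ⬝ᵥ rlsEstimate P₀ θ₀ y φ k)) •
        (rlsMatrix P₀ φ k *ᵥ φ (k + 1))

/-- The unit vector `x_k`; with coordinates counted from `0`, its nonzero coordinate is
`k mod N`. -/
def selector (N k : ℕ) : Fin N → ℝ := fun i => if (i : ℕ) = k % N then 1 else 0

/-- The transmitted bit: `1` if `p > q`, and `-1` if `p ≤ q`. -/
def oneBit (p q : ℝ) : ℝ := if q < p then 1 else -1

/-- The remote estimates `θ̂_k`, driven by the bits
`s_k = oneBit (x_kᵀ θ̂_k^RLS) (x_kᵀ θ̂_{k-1})`; `θL k` is the local estimate at time `k`. -/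
def remoteEstimate (α : ℝ) (β : ℕ → ℝ) (θ₀ : Fin N → ℝ) (θL : ℕ → Fin N → ℝ) : ℕ → Fin N → ℝ
  | 0 => θ₀
  | k + 1 =>
    remoteEstimate α β θ₀ θL k +
      (β (k + 1) *
        (oneBit (selector N (k + 1) ⬝ᵥ θL (k + 1))
            (selector N (k + 1) ⬝ᵥ remoteEstimate α β θ₀ θL k)
          / ((k + 1 : ℕ) : ℝ) ^ α)) • selector N (k + 1)

/-- The tracking gap `ω_k = x_kᵀ θ̂_k - x_kᵀ θ̂_{k+N}^RLS`, where `N = m + n`. -/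
def trackingGap (α : ℝ) (β : ℕ → ℝ) (θ₀ : Fin N → ℝ) (θL : ℕ → Fin N → ℝ) (k : ℕ) : ℝ :=
  selector N k ⬝ᵥ remoteEstimate α β θ₀ θL k - selector N k ⬝ᵥ θL (k + N)

end Algorithm

/-- The local estimate at time `k` computed from the (random) data. -/
def localEstimate {Ω : Type*} {m n : ℕ} (P₀ : Matrix (Fin (m + n)) (Fin (m + n)) ℝ)
    (θ₀ : Fin (m + n) → ℝ) (y u : ℤ → Ω → ℝ) (ω : Ω) : ℕ → Fin (m + n) → ℝ :=
  rlsEstimate P₀ θ₀ (fun k : ℕ => y k ω)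
    (fun k : ℕ => regressor m n (fun t => y t ω) (fun t => u t ω) k)

end

end ArxOneBit

/-! Write N = m + n. The theorem combines a pathwise tracking argument with the statement that its
hypotheses fail with probability smaller than every power of 1/k.

Tracking. A coordinate is updated once every N steps, and the bit sent at time k + N is opposite in
sign to the gap at time k, since the gap is formed with the local estimate of time k + N. If local
estimates move by at most βlow / (3N) · l^(-α) per step, one round brings the gap closer to zero by
at least (2βlow / 3) l^(-α), l being the update time, or leaves it below (βup + βlow / 3) l^(-α). A
tube of radius ρ l^(-α) is not left at large times, because it narrows over one round by less than
one descent. Starting near time k^((1-α)/2), where the gap is O(k^((1-α)/2)), the total descent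
available up to time k is of order k^(1-α), which is larger; so the gap has entered the tube by time
k (`eventually_abs_trackingGap_le`).

Slow drift of least squares. The information matrix R_k is the inverse of P_k, and the error energy
(θ̂_k - θ)ᵀ R_k (θ̂_k - θ) grows by at most d_{k+1}² per step. If R_k ≥ κk, regressor entries and
noise are at most k^ε, and the sum of the d_j² is at most k^(1+ε), the estimation error is O(k^ε)
and the next increment is O(k^(3ε-1)), which is o(k^(-α)) for ε = (1-α)/4 (`rls_step_bounds`,
`negligible_localEstimate_increment`). Consistency of the local estimate is not needed.

Probability. Size bounds follow from Markov's inequality with high moments. For R_k ≥ κk, regressors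
are filtered noise, so their centred products are absolutely summable combinations of centred
products of two noise variables. For fixed lags these are martingale differences in time, so their
sums over T times have 2q-th moment O(T^q), uniformly in the lags; Jensen's inequality for the
filter weights carries this to the regressors (`integral_sum_filterOutput_mul_pow_le`). With the
limiting mean positive definite, R_k grows linearly off a negligible event
(`negligible_infoMatrix_lt`). A union bound over the polynomially many times of the window loses
only powers of k (`Negligible.window`). -/

namespace ArxOneBit

/-! ### Recursive least squares: deterministic error and increment bounds. -/

section RecursiveLeastSquares

variable {N : ℕ}

/-- The information matrix `P₀⁻¹ + ∑_{j ≤ k} φ_j φ_jᵀ` of recursive least squares. -/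
noncomputable def infoMatrix (P₀ : Matrix (Fin N) (Fin N) ℝ) (φ : ℕ → Fin N → ℝ) (k : ℕ) :
    Matrix (Fin N) (Fin N) ℝ :=
  P₀⁻¹ + ∑ j ∈ Finset.range k, vecMulVec (φ (j + 1)) (φ (j + 1))

lemma infoMatrix_succ (P₀ : Matrix (Fin N) (Fin N) ℝ) (φ : ℕ → Fin N → ℝ) (k : ℕ) :
    infoMatrix P₀ φ (k + 1) = infoMatrix P₀ φ k + vecMulVec (φ (k + 1)) (φ (k + 1)) := by
  simp [infoMatrix, Finset.sum_range_succ, add_assoc]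

lemma infoMatrix_posDef {P₀ : Matrix (Fin N) (Fin N) ℝ} (hP₀ : P₀.PosDef) (φ : ℕ → Fin N → ℝ)
    (k : ℕ) : (infoMatrix P₀ φ k).PosDef := by
  refine hP₀.inv.add_posSemidef ?_
  refine Matrix.posSemidef_sum _ fun j _ => ?_
  simpa using Matrix.posSemidef_vecMulVec_self_star (φ (j + 1))

lemma dotProduct_mulVec_nonneg_of_posDef {Q : Matrix (Fin N) (Fin N) ℝ} (hQ : Q.PosDef)
    (v : Fin N → ℝ) : 0 ≤ v ⬝ᵥ (Q *ᵥ v) := by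
  simpa using hQ.posSemidef.dotProduct_mulVec_nonneg v

lemma rlsGain_pos {Q : Matrix (Fin N) (Fin N) ℝ} (hQ : Q.PosDef) (v : Fin N → ℝ) :
    0 < rlsGain Q v := by
  have := dotProduct_mulVec_nonneg_of_posDef hQ v
  unfold rlsGain; positivity

lemma rlsGain_le_one {Q : Matrix (Fin N) (Fin N) ℝ} (hQ : Q.PosDef) (v : Fin N → ℝ) :
    rlsGain Q v ≤ 1 := by
  have := dotProduct_mulVec_nonneg_of_posDef hQ v
  exact inv_le_one_of_one_le₀ (by linarith)

lemma rlsGain_mul {Q : Matrix (Fin N) (Fin N) ℝ} (hQ : Q.PosDef) (v : Fin N → ℝ) :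
    rlsGain Q v * (1 + v ⬝ᵥ (Q *ᵥ v)) = 1 := by
  have := dotProduct_mulVec_nonneg_of_posDef hQ v
  exact inv_mul_cancel₀ (by positivity)

/-- `P_k` is the inverse of the information matrix. -/
lemma rlsMatrix_eq_inv {P₀ : Matrix (Fin N) (Fin N) ℝ} (hP₀ : P₀.PosDef) (φ : ℕ → Fin N → ℝ)
    (k : ℕ) : rlsMatrix P₀ φ k = (infoMatrix P₀ φ k)⁻¹ := by
  induction k with
  | zero =>
    have := hP₀.isUnit
    rw [Matrix.isUnit_iff_isUnit_det] at this
    simp [rlsMatrix, infoMatrix, Matrix.nonsing_inv_nonsing_inv _ this]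
  | succ k ih =>
    have hQ : (rlsMatrix P₀ φ k).PosDef := ih ▸ (infoMatrix_posDef hP₀ φ k).inv
    have hQR : rlsMatrix P₀ φ k * infoMatrix P₀ φ k = 1 := by
      have := (infoMatrix_posDef hP₀ φ k).isUnit
      rw [Matrix.isUnit_iff_isUnit_det] at this
      rw [ih, Matrix.nonsing_inv_mul _ this]
    symm
    apply Matrix.inv_eq_left_inv
    rw [infoMatrix_succ]
    simp only [rlsMatrix]
    set Q := rlsMatrix P₀ φ k
    set v := φ (k + 1)
    set R := infoMatrix P₀ φ k
    have hg := rlsGain_mul hQ v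
    set g := rlsGain Q v
    have e1 : Q * vecMulVec v v * Q * R = vecMulVec (Q *ᵥ v) v := by
      rw [Matrix.mul_assoc _ Q R, hQR, Matrix.mul_one, Matrix.mul_vecMulVec]
    have e2 : Q * vecMulVec v v * Q * vecMulVec v v
        = (v ⬝ᵥ (Q *ᵥ v)) • vecMulVec (Q *ᵥ v) v := by
      rw [Matrix.mul_assoc _ Q, Matrix.mul_vecMulVec, Matrix.mul_vecMulVec,
        Matrix.vecMulVec_mulVec]
      ext i j
      simp [vecMulVec_apply]
      ring
    rw [sub_mul, mul_add, mul_add, smul_mul_assoc, smul_mul_assoc, hQR, e1, e2,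
      Matrix.mul_vecMulVec, add_sub_assoc, smul_smul]
    -- Sherman–Morrison: besides the identity, the product is a multiple of (Qv)vᵀ, and this is its
    -- coefficient.
    have : (1 : ℝ) - g - g * (v ⬝ᵥ (Q *ᵥ v)) = 0 := by linarith
    rw [← sub_sub]
    nth_rewrite 1 [← one_smul ℝ (vecMulVec (Q *ᵥ v) v)]
    rw [← sub_smul, ← sub_smul, this, zero_smul, add_zero]

lemma rlsMatrix_posDef {P₀ : Matrix (Fin N) (Fin N) ℝ} (hP₀ : P₀.PosDef) (φ : ℕ → Fin N → ℝ)
    (k : ℕ) : (rlsMatrix P₀ φ k).PosDef :=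
  rlsMatrix_eq_inv hP₀ φ k ▸ (infoMatrix_posDef hP₀ φ k).inv

lemma infoMatrix_mul_rlsMatrix {P₀ : Matrix (Fin N) (Fin N) ℝ} (hP₀ : P₀.PosDef)
    (φ : ℕ → Fin N → ℝ) (k : ℕ) : infoMatrix P₀ φ k * rlsMatrix P₀ φ k = 1 := by
  have := (infoMatrix_posDef hP₀ φ k).isUnit
  rw [Matrix.isUnit_iff_isUnit_det] at this
  rw [rlsMatrix_eq_inv hP₀, Matrix.mul_nonsing_inv _ this]

lemma dotProduct_infoMatrix_symm {P₀ : Matrix (Fin N) (Fin N) ℝ} (hP₀ : P₀.PosDef)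
    (φ : ℕ → Fin N → ℝ) (k : ℕ) (v w : Fin N → ℝ) :
    v ⬝ᵥ (infoMatrix P₀ φ k *ᵥ w) = w ⬝ᵥ (infoMatrix P₀ φ k *ᵥ v) := by
  have h : (infoMatrix P₀ φ k)ᵀ = infoMatrix P₀ φ k := by
    simpa using (infoMatrix_posDef hP₀ φ k).isHermitian.eq
  rw [dotProduct_mulVec, dotProduct_comm, ← mulVec_transpose, h]

/-- The energy of the estimation error with respect to a parameter `θ`, measured in the
information matrix, grows by at most the squared equation error. -/
lemma rls_energy_succ_le {P₀ : Matrix (Fin N) (Fin N) ℝ} (hP₀ : P₀.PosDef) (θ₀ θ : Fin N → ℝ)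
    (y : ℕ → ℝ) (φ : ℕ → Fin N → ℝ) (k : ℕ) :
    (rlsEstimate P₀ θ₀ y φ (k + 1) - θ) ⬝ᵥ
        (infoMatrix P₀ φ (k + 1) *ᵥ (rlsEstimate P₀ θ₀ y φ (k + 1) - θ))
      ≤ (rlsEstimate P₀ θ₀ y φ k - θ) ⬝ᵥ (infoMatrix P₀ φ k *ᵥ (rlsEstimate P₀ θ₀ y φ k - θ))
        + (y (k + 1) - φ (k + 1) ⬝ᵥ θ) ^ 2 := by
  have hQ := rlsMatrix_posDef hP₀ φ k
  have hRQ := infoMatrix_mul_rlsMatrix hP₀ φ k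
  have hsymm := dotProduct_infoMatrix_symm hP₀ φ k
  rw [infoMatrix_succ]
  simp only [rlsEstimate]
  set Q := rlsMatrix P₀ φ k
  set v := φ (k + 1)
  set R := infoMatrix P₀ φ k
  have hg := rlsGain_mul hQ v
  have hg0 := rlsGain_pos hQ v
  set g := rlsGain Q v
  set t := rlsEstimate P₀ θ₀ y φ k
  set ε := y (k + 1) - v ⬝ᵥ t with hε
  set w := t - θ with hw
  have e0 : t + (g * ε) • Q *ᵥ v - θ = w + (g * ε) • Q *ᵥ v := by rw [hw]; abel
  have e1 : R *ᵥ (Q *ᵥ v) = v := by rw [mulVec_mulVec, hRQ, one_mulVec]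
  have e2 : (Q *ᵥ v) ⬝ᵥ (R *ᵥ w) = v ⬝ᵥ w := by rw [hsymm, e1, dotProduct_comm]
  have e3 : y (k + 1) - v ⬝ᵥ θ = ε + v ⬝ᵥ w := by rw [hε, hw, dotProduct_sub]; ring
  rw [e0, e3]
  simp only [add_mulVec, mulVec_add, mulVec_smul, dotProduct_add, add_dotProduct, smul_dotProduct,
    dotProduct_smul, smul_eq_mul, e1, e2, vecMulVec_mulVec, dotProduct_comm w v,
    dotProduct_comm (Q *ᵥ v) v, op_smul_eq_smul, smul_eq_mul]
  set s := v ⬝ᵥ Q *ᵥ v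
  set x := v ⬝ᵥ w
  -- With this relation the new energy is exactly the old one plus (ε + x)² - g ε²; dropping g ε²
  -- gives the inequality.
  have hs : g * s = 1 - g := by linarith
  have : 0 ≤ g * ε ^ 2 := by positivity
  linear_combination this + (g * ε ^ 2 + 2 * x * ε + ε ^ 2 * (g * s + 1 - g)) * hs

lemma rls_energy_le {P₀ : Matrix (Fin N) (Fin N) ℝ} (hP₀ : P₀.PosDef) (θ₀ θ : Fin N → ℝ)
    (y : ℕ → ℝ) (φ : ℕ → Fin N → ℝ) (k : ℕ) :
    (rlsEstimate P₀ θ₀ y φ k - θ) ⬝ᵥ (infoMatrix P₀ φ k *ᵥ (rlsEstimate P₀ θ₀ y φ k - θ))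
      ≤ (θ₀ - θ) ⬝ᵥ (P₀⁻¹ *ᵥ (θ₀ - θ))
        + ∑ j ∈ Finset.range k, (y (j + 1) - φ (j + 1) ⬝ᵥ θ) ^ 2 := by
  induction k with
  | zero => simp [rlsEstimate, infoMatrix]
  | succ k ih =>
    rw [Finset.sum_range_succ]
    linarith [rls_energy_succ_le hP₀ θ₀ θ y φ k]

/-- If the information matrix is at least `c`, then `P_k` is at most `1 / c` in Euclidean norm. -/
lemma rlsMatrix_mulVec_sq_le {P₀ : Matrix (Fin N) (Fin N) ℝ} (hP₀ : P₀.PosDef)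
    (φ : ℕ → Fin N → ℝ) (k : ℕ) {c : ℝ} (hc : 0 < c)
    (h : ∀ v, c * (v ⬝ᵥ v) ≤ v ⬝ᵥ (infoMatrix P₀ φ k *ᵥ v)) (v : Fin N → ℝ) :
    c ^ 2 * ((rlsMatrix P₀ φ k *ᵥ v) ⬝ᵥ (rlsMatrix P₀ φ k *ᵥ v)) ≤ v ⬝ᵥ v := by
  have h1 := h (rlsMatrix P₀ φ k *ᵥ v)
  -- For w = P_k v the excitation bound reads c |w|² ≤ w · v, and Cauchy–Schwarz finishes.
  rw [mulVec_mulVec, infoMatrix_mul_rlsMatrix hP₀, one_mulVec] at h1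
  set w := rlsMatrix P₀ φ k *ᵥ v
  have h0 : ∑ i, (c * w i - v i) ^ 2 = c ^ 2 * (w ⬝ᵥ w) - 2 * c * (w ⬝ᵥ v) + v ⬝ᵥ v := by
    simp only [dotProduct, Finset.mul_sum, ← Finset.sum_sub_distrib, ← Finset.sum_add_distrib]
    exact Finset.sum_congr rfl fun i _ => by ring
  have h2 : (w ⬝ᵥ v) ^ 2 ≤ (w ⬝ᵥ w) * (v ⬝ᵥ v) := by
    simpa [dotProduct, sq] using Finset.sum_mul_sq_le_sq_mul_sq Finset.univ w v
  have hww : 0 ≤ w ⬝ᵥ w := Finset.sum_nonneg fun i _ => mul_self_nonneg (w i)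
  have hvv : 0 ≤ v ⬝ᵥ v := Finset.sum_nonneg fun i _ => mul_self_nonneg (v i)
  rcases hww.eq_or_lt with h3 | h3
  · rw [← h3]; simpa using hvv
  · have h4 : (c * (w ⬝ᵥ w)) ^ 2 ≤ (w ⬝ᵥ w) * (v ⬝ᵥ v) :=
      (pow_le_pow_left₀ (by positivity) h1 2).trans h2
    refine le_of_mul_le_mul_left ?_ h3
    linarith [h4, show (c * (w ⬝ᵥ w)) ^ 2 = (w ⬝ᵥ w) * (c ^ 2 * (w ⬝ᵥ w)) by ring]

lemma sq_le_dotProduct_self (v : Fin N → ℝ) (i : Fin N) : v i ^ 2 ≤ v ⬝ᵥ v := by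
  have := Finset.single_le_sum (f := fun i => v i * v i) (fun i _ => mul_self_nonneg (v i))
    (Finset.mem_univ i)
  simpa [dotProduct, sq] using this

lemma dotProduct_self_le (v : Fin N → ℝ) {B : ℝ} (h : ∀ i, |v i| ≤ B) :
    v ⬝ᵥ v ≤ N * B ^ 2 := by
  have : ∀ i ∈ Finset.univ, v i * v i ≤ B ^ 2 := fun i _ => by
    rw [← sq, ← sq_abs]; exact pow_le_pow_left₀ (abs_nonneg _) (h i) 2
  simpa [dotProduct] using Finset.sum_le_card_nsmul _ _ _ this

lemma abs_dotProduct_le (v w : Fin N → ℝ) {A B : ℝ} (hA : 0 ≤ A) (hv : ∀ i, |v i| ≤ A)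
    (hw : ∀ i, |w i| ≤ B) : |v ⬝ᵥ w| ≤ N * (A * B) := by
  have : ∀ i ∈ Finset.univ, |v i * w i| ≤ A * B := fun i _ => by
    rw [abs_mul]; exact mul_le_mul (hv i) (hw i) (abs_nonneg _) hA
  simpa [dotProduct] using (Finset.abs_sum_le_sum_abs _ _).trans
    (Finset.sum_le_card_nsmul _ _ _ this)

/-- Deterministic bounds for one step of recursive least squares, in terms of bounds on the
excitation `c`, the regressor `A`, the current equation error `A`, and the energy `E`. -/
lemma rls_step_bounds {P₀ : Matrix (Fin N) (Fin N) ℝ} (hP₀ : P₀.PosDef) (θ₀ θ : Fin N → ℝ)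
    (y : ℕ → ℝ) (φ : ℕ → Fin N → ℝ) (k : ℕ) {c A B : ℝ} (hc : 0 < c) (hA : 0 ≤ A) (hB : 0 ≤ B)
    (h : ∀ v, c * (v ⬝ᵥ v) ≤ v ⬝ᵥ (infoMatrix P₀ φ k *ᵥ v))
    (hφ : ∀ i, |φ (k + 1) i| ≤ A) (hd : |y (k + 1) - φ (k + 1) ⬝ᵥ θ| ≤ A)
    (hE : (θ₀ - θ) ⬝ᵥ (P₀⁻¹ *ᵥ (θ₀ - θ))
        + ∑ j ∈ Finset.range k, (y (j + 1) - φ (j + 1) ⬝ᵥ θ) ^ 2 ≤ c * B ^ 2) (i : Fin N) :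
    |rlsEstimate P₀ θ₀ y φ k i - θ i| ≤ B ∧
    |rlsEstimate P₀ θ₀ y φ (k + 1) i - rlsEstimate P₀ θ₀ y φ k i|
      ≤ (A + N * (A * B)) * (N * A / c) := by
  have hQ := rlsMatrix_posDef hP₀ φ k
  have herr : ∀ i, |rlsEstimate P₀ θ₀ y φ k i - θ i| ≤ B := by
    intro i
    have h1 := (h _).trans ((rls_energy_le hP₀ θ₀ θ y φ k).trans hE)
    have h2 := sq_le_dotProduct_self (rlsEstimate P₀ θ₀ y φ k - θ) i
    exact abs_le_of_sq_le_sq (h2.trans (le_of_mul_le_mul_left h1 hc)) hB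
  refine ⟨herr i, ?_⟩
  have hN : (1 : ℝ) ≤ N := by exact_mod_cast i.pos
  have hw : |(rlsMatrix P₀ φ k *ᵥ φ (k + 1)) i| ≤ N * A / c := by
    have h1 := rlsMatrix_mulVec_sq_le hP₀ φ k hc h (φ (k + 1))
    have h2 := sq_le_dotProduct_self (rlsMatrix P₀ φ k *ᵥ φ (k + 1)) i
    have h3 := dotProduct_self_le (φ (k + 1)) hφ
    refine abs_le_of_sq_le_sq ?_ (by positivity)
    rw [div_pow, le_div_iff₀ (by positivity)]
    -- The factor √N is weakened to N so that no square root enters the bound.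
    have h4 : (N : ℝ) * A ^ 2 ≤ (N * A) ^ 2 := by
      rw [mul_pow]; exact mul_le_mul_of_nonneg_right (by nlinarith) (by positivity)
    nlinarith [mul_le_mul_of_nonneg_left h2 (sq_nonneg c)]
  have hres : |y (k + 1) - φ (k + 1) ⬝ᵥ rlsEstimate P₀ θ₀ y φ k| ≤ A + N * (A * B) := by
    have h1 := abs_dotProduct_le (φ (k + 1)) (rlsEstimate P₀ θ₀ y φ k - θ) hA hφ herr
    have h2 : y (k + 1) - φ (k + 1) ⬝ᵥ rlsEstimate P₀ θ₀ y φ k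
        = (y (k + 1) - φ (k + 1) ⬝ᵥ θ) - φ (k + 1) ⬝ᵥ (rlsEstimate P₀ θ₀ y φ k - θ) := by
      rw [dotProduct_sub]; ring
    rw [h2]
    exact (abs_sub _ _).trans (add_le_add hd h1)
  simp only [rlsEstimate, Pi.add_apply, Pi.smul_apply, smul_eq_mul, add_sub_cancel_left]
  rw [abs_mul, abs_mul, abs_of_pos (rlsGain_pos hQ _)]
  have hg := rlsGain_le_one hQ (φ (k + 1))
  have hg0 := rlsGain_pos hQ (φ (k + 1))
  refine mul_le_mul ?_ hw (abs_nonneg _) (by positivity)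
  calc _ ≤ 1 * |y (k + 1) - φ (k + 1) ⬝ᵥ rlsEstimate P₀ θ₀ y φ k| := by gcongr
    _ ≤ _ := by rw [one_mul]; exact hres

end RecursiveLeastSquares

/-! ### Tracking by one-bit updates along a fixed path. -/

section Tracking

lemma eventually_mul_rpow_le {s t : ℝ} (hst : s < t) (C : ℝ) {ε : ℝ} (hε : 0 < ε) :
    ∀ᶠ k : ℕ in atTop, C * (k : ℝ) ^ s ≤ ε * (k : ℝ) ^ t := by
  have h : Tendsto (fun k : ℕ => (k : ℝ) ^ (t - s)) atTop atTop :=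
    (tendsto_rpow_atTop (sub_pos.2 hst)).comp tendsto_natCast_atTop_atTop
  filter_upwards [h.eventually_ge_atTop (C / ε), eventually_ge_atTop 1] with k hk hk1
  have hk0 : (0 : ℝ) < k := by exact_mod_cast hk1
  rw [div_le_iff₀ hε] at hk
  have : (k : ℝ) ^ t = (k : ℝ) ^ (t - s) * (k : ℝ) ^ s := by
    rw [← Real.rpow_add hk0]; ring_nf
  rw [this, ← mul_assoc, mul_comm ε]
  gcongr

variable {N : ℕ}

lemma selector_dotProduct (hN : 0 < N) (k : ℕ) (v : Fin N → ℝ) :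
    selector N k ⬝ᵥ v = v ⟨k % N, Nat.mod_lt k hN⟩ := by
  rw [dotProduct, Finset.sum_eq_single ⟨k % N, Nat.mod_lt k hN⟩]
  · simp [selector]
  · intro i _ hi
    simp [selector, Fin.ext_iff] at hi ⊢
    exact fun h => absurd h hi
  · simp

lemma selector_add_self (k : ℕ) : selector N (k + N) = selector N k := by
  ext i; simp [selector]

variable (α : ℝ) (β : ℕ → ℝ) (θ₀ : Fin N → ℝ) (θL : ℕ → Fin N → ℝ)

lemma remoteEstimate_succ_of_ne (k : ℕ) (i : Fin N) (hi : (i : ℕ) ≠ (k + 1) % N) :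
    remoteEstimate α β θ₀ θL (k + 1) i = remoteEstimate α β θ₀ θL k i := by
  simp [remoteEstimate, selector, hi]

/-- Between two consecutive updates, a coordinate of the remote estimate is constant. -/
lemma remoteEstimate_add_of_lt (hN : 0 < N) (k j : ℕ) (hj : j < N) :
    remoteEstimate α β θ₀ θL (k + j) ⟨k % N, Nat.mod_lt k hN⟩
      = remoteEstimate α β θ₀ θL k ⟨k % N, Nat.mod_lt k hN⟩ := by
  induction j with
  | zero => rfl
  | succ j ih =>
    rw [← ih (by omega), ← add_assoc, remoteEstimate_succ_of_ne]
    intro h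
    have h1 : (k + 0) ≡ (k + (j + 1)) [MOD N] := by simpa [Nat.ModEq, add_assoc] using h
    have h2 := Nat.ModEq.add_left_cancel' k h1
    rw [Nat.ModEq, Nat.zero_mod, Nat.mod_eq_of_lt hj] at h2
    omega

/-- The coordinate selected at time k is next updated at time k + N, and its bit compares the
unchanged remote value with the local estimate of time k + N: exactly the two quantities in the gap.
So s opposes the sign of the gap; a tie gives -1. -/
lemma trackingGap_add (hN : 0 < N) (k : ℕ) :
    ∃ s : ℝ, (trackingGap α β θ₀ θL k ≤ 0 → s = 1 ∨ trackingGap α β θ₀ θL k = 0 ∧ s = -1) ∧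
      (0 < trackingGap α β θ₀ θL k → s = -1) ∧
      trackingGap α β θ₀ θL (k + N) = trackingGap α β θ₀ θL k
        + β (k + N) * (s / ((k + N : ℕ) : ℝ) ^ α)
        + (θL (k + N) ⟨k % N, Nat.mod_lt k hN⟩ - θL (k + N + N) ⟨k % N, Nat.mod_lt k hN⟩) := by
  have h1 : remoteEstimate α β θ₀ θL (k + N) ⟨k % N, Nat.mod_lt k hN⟩ =
      remoteEstimate α β θ₀ θL k ⟨k % N, Nat.mod_lt k hN⟩ + β (k + N) *
        (oneBit (θL (k + N) ⟨k % N, Nat.mod_lt k hN⟩)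
          (remoteEstimate α β θ₀ θL k ⟨k % N, Nat.mod_lt k hN⟩) / ((k + N : ℕ) : ℝ) ^ α) := by
    obtain ⟨M, rfl⟩ : ∃ M, N = M + 1 := ⟨N - 1, by omega⟩
    rw [← remoteEstimate_add_of_lt α β θ₀ θL hN k M (by omega)]
    rw [show k + (M + 1) = (k + M) + 1 by ring]
    have hs : selector (M + 1) (k + M + 1) = selector (M + 1) k := selector_add_self k
    simp only [remoteEstimate, hs, Pi.add_apply, Pi.smul_apply, selector_dotProduct hN, smul_eq_mul]
    simp [selector]
  refine ⟨oneBit (θL (k + N) ⟨k % N, Nat.mod_lt k hN⟩)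
          (remoteEstimate α β θ₀ θL k ⟨k % N, Nat.mod_lt k hN⟩), ?_, ?_, ?_⟩
  · simp only [trackingGap, selector_dotProduct hN, oneBit]
    intro h
    split_ifs with h2
    · exact Or.inl rfl
    · exact Or.inr ⟨by linarith, rfl⟩
  · simp only [trackingGap, selector_dotProduct hN, oneBit]
    intro h
    rw [if_neg (by linarith)]
  · rw [trackingGap, trackingGap, selector_add_self]
    simp only [selector_dotProduct hN]
    rw [h1]; ring

lemma abs_sub_le_of_steps (x : ℕ → ℝ) (l M : ℕ) {δ : ℝ}
    (h : ∀ j < M, |x (l + j + 1) - x (l + j)| ≤ δ) : |x l - x (l + M)| ≤ M * δ := by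
  induction M with
  | zero => simp
  | succ M ih =>
    have h1 := ih fun j hj => h j (by omega)
    have h2 := h M (by omega)
    rw [abs_sub_comm] at h2
    push_cast
    have := abs_sub_le (x l) (x (l + M)) (x (l + (M + 1)))
    rw [← add_assoc] at this ⊢
    linarith

/-- Over the N local steps the drift is at most a third of the smallest update. If the gap keeps its
sign, its size falls by at least the update minus the drift; if it changes sign, the overshoot is at
most the largest update plus the drift. -/
lemma abs_trackingGap_add_le (hN : 0 < N) {βlow βup : ℝ} (hβlow : 0 < βlow)
    (hβ : ∀ k ≥ 1, βlow ≤ β k ∧ β k ≤ βup) (hα : 0 ≤ α) (k : ℕ)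
    (h : ∀ l, k + N ≤ l → l < k + N + N →
      ∀ i, |θL (l + 1) i - θL l i| ≤ βlow / (3 * N) / (l : ℝ) ^ α) :
    |trackingGap α β θ₀ θL (k + N)| ≤
      max (|trackingGap α β θ₀ θL k| - 2 * βlow / 3 / ((k + N : ℕ) : ℝ) ^ α)
        ((βup + βlow / 3) / ((k + N : ℕ) : ℝ) ^ α) := by
  obtain ⟨s, hs1, hs2, hs⟩ := trackingGap_add α β θ₀ θL hN k
  have hkN : (0 : ℝ) < ((k + N : ℕ) : ℝ) := by exact_mod_cast (by omega : 0 < k + N)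
  have hpow : 0 < ((k + N : ℕ) : ℝ) ^ α := Real.rpow_pos_of_pos hkN _
  have hNr : (0 : ℝ) < N := by exact_mod_cast hN
  have hδ := abs_sub_le_of_steps (fun l => θL l ⟨k % N, Nat.mod_lt k hN⟩) (k + N) N
    (δ := βlow / (3 * N) / ((k + N : ℕ) : ℝ) ^ α) fun j hj => by
      refine (h (k + N + j) (by omega) (by omega) _).trans ?_
      have : ((k + N : ℕ) : ℝ) ≤ ((k + N + j : ℕ) : ℝ) := by exact_mod_cast Nat.le_add_right _ _
      gcongr
  have e : (N : ℝ) * (βlow / (3 * N) / ((k + N : ℕ) : ℝ) ^ α)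
      = βlow / 3 / ((k + N : ℕ) : ℝ) ^ α := by field_simp
  rw [e] at hδ
  set δ := θL (k + N) ⟨k % N, Nat.mod_lt k hN⟩ - θL (k + N + N) ⟨k % N, Nat.mod_lt k hN⟩
  change |δ| ≤ _ at hδ
  set w := trackingGap α β θ₀ θL k
  set X := ((k + N : ℕ) : ℝ) ^ α
  obtain ⟨hb1, hb2⟩ := hβ (k + N) (by omega)
  have hb1' : βlow / X ≤ β (k + N) / X := by gcongr
  have hb2' : β (k + N) / X ≤ βup / X := by gcongr
  have hb0 : 0 < βlow / X := by positivity
  have r1 : (βup + βlow / 3) / X = βup / X + βlow / X / 3 := by ring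
  have r2 : 2 * βlow / 3 / X = 2 * (βlow / X) / 3 := by ring
  have r3 : βlow / 3 / X = βlow / X / 3 := by ring
  rw [r3, abs_le] at hδ
  rw [hs, r1, r2, le_max_iff]
  rcases lt_or_ge 0 w with hw | hw
  · rw [hs2 hw, abs_of_pos hw, abs_le, abs_le,
      show β (k + N) * (-1 / X) = -(β (k + N) / X) by ring]
    rcases le_total (β (k + N) / X) w with h3 | h3
    · by_cases h4 : 0 ≤ w - β (k + N) / X + δ
      · left; constructor <;> linarith
      · right; constructor <;> linarith
    · right; constructor <;> linarith
  · rcases hs1 hw with h4 | ⟨h4, h5⟩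
    · rw [h4, abs_of_nonpos hw, abs_le, abs_le,
        show β (k + N) * (1 / X) = (β (k + N) / X) by ring]
      rcases le_total (β (k + N) / X) (-w) with h3 | h3
      · by_cases h4 : w + β (k + N) / X + δ ≤ 0
        · left; constructor <;> linarith
        · right; constructor <;> linarith
      · right; constructor <;> linarith
    · rw [h5, h4, show β (k + N) * (-1 / X) = -(β (k + N) / X) by ring]
      right; rw [abs_le]; constructor <;> linarith

/-- A crude bound, with 1 / k^α ≤ 1. It is enough because it is applied only at the start of the
window, at a time of order k^((1-α)/2). -/
lemma abs_remoteEstimate_le {βlow βup : ℝ} (hβlow : 0 < βlow)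
    (hβ : ∀ k ≥ 1, βlow ≤ β k ∧ β k ≤ βup) (hα : 0 ≤ α) (k : ℕ) (i : Fin N) :
    |remoteEstimate α β θ₀ θL k i| ≤ ∑ j, |θ₀ j| + βup * k := by
  induction k with
  | zero =>
    simpa [remoteEstimate] using
      Finset.single_le_sum (f := fun j => |θ₀ j|) (fun j _ => abs_nonneg _) (Finset.mem_univ i)
  | succ k ih =>
    simp only [remoteEstimate, Pi.add_apply, Pi.smul_apply, smul_eq_mul]
    refine (abs_add_le _ _).trans ?_
    push_cast
    rw [mul_add, mul_one, ← add_assoc]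
    refine add_le_add ih ?_
    obtain ⟨hb1, hb2⟩ := hβ (k + 1) (by omega)
    have hX : (1 : ℝ) ≤ ((k : ℝ) + 1) ^ α :=
      Real.one_le_rpow (by linarith [k.cast_nonneg (α := ℝ)]) hα
    have h1 : |selector N (k + 1) i| ≤ 1 := by
      unfold selector; split_ifs <;> simp
    have h2 : ∀ p q, |oneBit p q| = 1 := fun p q => by
      unfold oneBit; split_ifs <;> simp
    rw [abs_mul, abs_mul, abs_div, h2, abs_of_pos (by linarith : 0 < β (k + 1)),
      abs_of_pos (by linarith : 0 < ((k : ℝ) + 1) ^ α)]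
    have h3 : 1 / ((k : ℝ) + 1) ^ α ≤ 1 := by
      rw [div_le_one (by linarith)]; exact hX
    have h4 : 0 ≤ 1 / ((k : ℝ) + 1) ^ α := by positivity
    have h5 : 0 ≤ βup := by linarith
    calc _ ≤ βup * 1 * 1 := by
          gcongr
      _ = βup := by ring

variable {α}

/-- The ratio ((l + N) / l)^α is at most 1 + N / l, so narrowing the tube costs only ρN / l, less
than the descent c for large l. This keeps the gap inside the tube once it has entered. -/
lemma eventually_rpow_shift_le (N : ℕ) (hα' : α ≤ 1) {ρ c : ℝ} (hρ : 0 ≤ ρ)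
    (hc : 0 < c) : ∀ᶠ l : ℕ in atTop,
      ρ / (l : ℝ) ^ α - c / ((l + N : ℕ) : ℝ) ^ α ≤ ρ / ((l + N : ℕ) : ℝ) ^ α := by
  filter_upwards [tendsto_natCast_atTop_atTop.eventually_ge_atTop (ρ * N / c),
    eventually_ge_atTop 1] with l hl hl1
  have hl0 : (0 : ℝ) < l := by exact_mod_cast hl1
  rw [div_le_iff₀ hc] at hl
  have hX : 0 < (l : ℝ) ^ α := Real.rpow_pos_of_pos hl0 _
  have hlN : (0 : ℝ) < ((l + N : ℕ) : ℝ) := by push_cast; positivity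
  have hY : 0 < ((l + N : ℕ) : ℝ) ^ α := Real.rpow_pos_of_pos hlN _
  have h1 : ((l + N : ℕ) : ℝ) ^ α / (l : ℝ) ^ α ≤ 1 + N / l := by
    rw [← Real.div_rpow hlN.le hl0.le]
    have e : ((l + N : ℕ) : ℝ) / l = 1 + N / l := by push_cast; field_simp
    rw [e]
    have : (1 : ℝ) ≤ 1 + N / l := by
      have : (0 : ℝ) ≤ N / l := by positivity
      linarith
    simpa using Real.rpow_le_rpow_of_exponent_le this hα'
  rw [sub_le_iff_le_add, ← add_div, le_div_iff₀ hY]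
  have h2 : ρ * (N / l) ≤ c := by
    rw [mul_div_assoc', div_le_iff₀ hl0]; linarith
  calc ρ / (l : ℝ) ^ α * ((l + N : ℕ) : ℝ) ^ α
      = ρ * (((l + N : ℕ) : ℝ) ^ α / (l : ℝ) ^ α) := by ring
    _ ≤ ρ * (1 + N / l) := by gcongr
    _ ≤ ρ + c := by linarith

/-- If, on a long enough window before time `k`, the local estimates grow at most linearly and
vary slowly, then the tracking gap at time `k` is of the order of one step. -/
lemma eventually_abs_trackingGap_le (hN : 0 < N) {βlow βup : ℝ} (hβlow : 0 < βlow)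
    (hβ : ∀ k ≥ 1, βlow ≤ β k ∧ β k ≤ βup) (hα : 0 < α) (hα' : α < 1) :
    ∀ᶠ k : ℕ in atTop, ∀ θL : ℕ → Fin N → ℝ,
      (∀ l : ℕ, (k : ℝ) ^ ((1 - α) / 2) ≤ l → l ≤ 2 * k → ∀ i,
        |θL l i| ≤ l ∧ |θL (l + 1) i - θL l i| ≤ βlow / (3 * N) / (l : ℝ) ^ α) →
      |trackingGap α β θ₀ θL k| ≤ (βup + 2 * βlow / 3) / (k : ℝ) ^ α := by
  have hβup : 0 < βup := by have := hβ 1 le_rfl; linarith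
  have hNr : (0 : ℝ) < N := by exact_mod_cast hN
  obtain ⟨l₀, hl₀⟩ := eventually_atTop.1 (eventually_rpow_shift_le N hα'.le
    (ρ := βup + 2 * βlow / 3) (c := 2 * βlow / 3) (by positivity) (by positivity))
  have hγ : 0 < (1 - α) / 2 := by linarith
  have hlarge : Tendsto (fun k : ℕ => (k : ℝ) ^ ((1 - α) / 2)) atTop atTop :=
    (tendsto_rpow_atTop hγ).comp tendsto_natCast_atTop_atTop
  set C₀ := ∑ j, |θ₀ j| with hC₀
  have hC₀0 : 0 ≤ C₀ := Finset.sum_nonneg fun _ _ => abs_nonneg _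
  -- The exponent is (1 - α)/2 + α: an initial gap of order k^((1-α)/2), divided by a descent of
  -- order k^(-α) per round, must be less than the number of rounds, of order k. The constant
  -- collects the bounds for the gap at the starting time and for that time itself.
  have hdom := eventually_mul_rpow_le (show (1 + α) / 2 < 1 by linarith)
    (C₀ + (βup + 1) * (2 + N) + N + 2 * βlow / 3 / N * (2 + N))
    (show (0 : ℝ) < 2 * βlow / 3 / N by positivity)
  have hdom2 := eventually_mul_rpow_le (show (1 - α) / 2 < 1 by linarith) (2 + N)
    (show (0 : ℝ) < 1 by norm_num)
  filter_upwards [hlarge.eventually_ge_atTop (max l₀ 1), hdom, hdom2, eventually_ge_atTop N,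
    eventually_ge_atTop 1] with k hk hdom hdom2 hkN hk1 θL hθ
  have hkr : (1 : ℝ) ≤ k := by exact_mod_cast hk1
  rw [Real.rpow_one] at hdom hdom2
  set L := ⌈(k : ℝ) ^ ((1 - α) / 2)⌉₊ with hL
  have hL1 : (k : ℝ) ^ ((1 - α) / 2) ≤ L := Nat.le_ceil _
  have hL2 : (L : ℝ) < (k : ℝ) ^ ((1 - α) / 2) + 1 := Nat.ceil_lt_add_one (by positivity)
  have hx1 : 1 ≤ (k : ℝ) ^ ((1 - α) / 2) := (le_max_right _ _).trans hk
  have hLk : L ≤ k := by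
    have : (L : ℝ) ≤ k := by nlinarith
    exact_mod_cast this
  set I := (k - L) / N with hI
  have hIN : I * N ≤ k - L := Nat.div_mul_le_self _ _
  have hIN' : k - L < I * N + N := Nat.lt_div_mul_add hN
  -- The starting time: the one in [L, L + N) that is congruent to k modulo N, so that whole rounds
  -- lead from it to k.
  set b := k - I * N with hb
  have hbL : L ≤ b := by omega
  have hbL' : b < L + N := by omega
  have hbk : b + I * N = k := by omega
  have hl₀b : l₀ ≤ b := by
    have : (l₀ : ℝ) ≤ b := (le_max_left _ _).trans (hk.trans (hL1.trans (by exact_mod_cast hbL)))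
    exact_mod_cast this
  have hk0 : 0 < (k : ℝ) ^ α := Real.rpow_pos_of_pos (by linarith) _
  -- After j rounds the gap is either in the tube or has made j full descents, each bounded below by
  -- its value at time k.
  have hind : ∀ j ≤ I, |trackingGap α β θ₀ θL (b + j * N)| ≤
      max ((βup + 2 * βlow / 3) / ((b + j * N : ℕ) : ℝ) ^ α)
        (|trackingGap α β θ₀ θL b| - j * (2 * βlow / 3 / (k : ℝ) ^ α)) := by
    intro j
    induction j with
    | zero => intro _; simp
    | succ j ih =>
      intro hj
      have ih := ih (by omega)
      have hjI : (j + 1) * N ≤ I * N := Nat.mul_le_mul_right _ hj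
      have hstep := abs_trackingGap_add_le α β θ₀ θL hN hβlow hβ hα.le (b + j * N)
        fun l hl1 hl2 i => (hθ l (hL1.trans (by
          have : L ≤ l := by omega
          exact_mod_cast this)) (by nlinarith) i).2
      have hsh := hl₀ (b + j * N) (by omega)
      rw [show b + (j + 1) * N = b + j * N + N by ring]
      have hpos : 0 < ((b + j * N + N : ℕ) : ℝ) ^ α :=
        Real.rpow_pos_of_pos (by exact_mod_cast (by omega)) _
      have hle : ((b + j * N + N : ℕ) : ℝ) ^ α ≤ (k : ℝ) ^ α := by
        have : b + j * N + N ≤ k := by nlinarith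
        have : ((b + j * N + N : ℕ) : ℝ) ≤ k := by exact_mod_cast this
        gcongr
      have hdec : 2 * βlow / 3 / (k : ℝ) ^ α ≤ 2 * βlow / 3 / ((b + j * N + N : ℕ) : ℝ) ^ α := by
        gcongr
      have hthird : (βup + βlow / 3) / ((b + j * N + N : ℕ) : ℝ) ^ α
          ≤ (βup + 2 * βlow / 3) / ((b + j * N + N : ℕ) : ℝ) ^ α := by
        gcongr ?_ / _; linarith
      rcases le_max_iff.1 hstep with h1 | h1
      · rcases le_max_iff.1 ih with h2 | h2
        · exact le_max_of_le_left (by linarith)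
        · refine le_max_of_le_right ?_
          push_cast at *
          linarith
      · exact le_max_of_le_left (h1.trans hthird)
  have hfin := hind I le_rfl
  rw [hbk] at hfin
  rcases le_max_iff.1 hfin with h | h
  · exact h
  -- In the second case the total descent exceeds the initial gap, so the bound is nonpositive.
  refine h.trans (le_trans ?_ (by positivity : 0 ≤ (βup + 2 * βlow / 3) / (k : ℝ) ^ α))
  -- The gap looks N steps ahead; this is why the window extends past k.
  have hbk' : b + N ≤ 2 * k := by omega
  have hW : |trackingGap α β θ₀ θL b| ≤ C₀ + βup * b + (b + N) := by
    rw [trackingGap, selector_dotProduct hN, selector_dotProduct hN]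
    refine (abs_sub _ _).trans (add_le_add
      (abs_remoteEstimate_le α β θ₀ θL hβlow hβ hα.le b _) ?_)
    have := (hθ (b + N) (hL1.trans (by exact_mod_cast (by omega : L ≤ b + N))) hbk'
      ⟨b % N, Nat.mod_lt b hN⟩).1
    push_cast at this
    exact this
  have hbr : (b : ℝ) ≤ (2 + N) * (k : ℝ) ^ ((1 - α) / 2) := by
    have : (b : ℝ) ≤ L + N := by exact_mod_cast hbL'.le
    nlinarith
  have hIr : (k : ℝ) - b = I * N := by
    rw [← hbk]; push_cast; ring
  have hmul : (k : ℝ) ^ ((1 - α) / 2) * (k : ℝ) ^ α = (k : ℝ) ^ ((1 + α) / 2) := by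
    rw [← Real.rpow_add (by linarith)]; ring_nf
  have hle1 : (k : ℝ) ^ α ≤ (k : ℝ) ^ ((1 + α) / 2) :=
    Real.rpow_le_rpow_of_exponent_le hkr (by linarith)
  have hle2 : (k : ℝ) ^ ((1 - α) / 2) ≤ (k : ℝ) ^ ((1 + α) / 2) :=
    Real.rpow_le_rpow_of_exponent_le hkr (by linarith)
  have hI' : (I : ℝ) = (k - b) / N := by rw [hIr]; field_simp
  rw [mul_div_assoc', sub_nonpos, le_div_iff₀ hk0, hI']
  have hW2 : |trackingGap α β θ₀ θL b| * (k : ℝ) ^ α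
      ≤ (C₀ + (βup + 1) * (2 + N) + N) * (k : ℝ) ^ ((1 + α) / 2) := by
    calc |trackingGap α β θ₀ θL b| * (k : ℝ) ^ α
        ≤ (C₀ + (βup + 1) * ((2 + N) * (k : ℝ) ^ ((1 - α) / 2)) + N) * (k : ℝ) ^ α := by
          gcongr
          nlinarith
      _ = (C₀ + N) * (k : ℝ) ^ α + (βup + 1) * (2 + N) *
          ((k : ℝ) ^ ((1 - α) / 2) * (k : ℝ) ^ α) := by ring
      _ ≤ (C₀ + N) * (k : ℝ) ^ ((1 + α) / 2) + (βup + 1) * (2 + N) *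
          (k : ℝ) ^ ((1 + α) / 2) := by rw [hmul]; gcongr
      _ = _ := by ring
  have hb3 : 2 * βlow / 3 / N * b ≤ 2 * βlow / 3 / N * (2 + N) * (k : ℝ) ^ ((1 + α) / 2) := by
    rw [mul_assoc]
    gcongr
    exact hbr.trans (by gcongr)
  have : (k - b : ℝ) / N * (2 * βlow / 3) = 2 * βlow / 3 / N * k - 2 * βlow / 3 / N * b := by ring
  rw [this]
  linarith

end Tracking

/-! ### Finite moments and a moment inequality for orthogonal increments. -/

section Moments

variable {Ω : Type*} [MeasurableSpace Ω] {P : Measure Ω}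

/-- `X` has finite moments of all orders. -/
def HasMoments (P : Measure Ω) (X : Ω → ℝ) : Prop :=
  ∀ p : ENNReal, p ≠ ⊤ → MemLp X p P

lemma HasMoments.of_nat [IsFiniteMeasure P] {X : Ω → ℝ} (h : ∀ q : ℕ, MemLp X q P) :
    HasMoments P X := fun p hp => by
  obtain ⟨n, hn⟩ := ENNReal.exists_nat_gt hp
  exact (h n).mono_exponent hn.le

lemma HasMoments.const [IsFiniteMeasure P] (c : ℝ) : HasMoments P fun _ => c :=
  fun _ _ => memLp_const c

lemma HasMoments.sub {X Y : Ω → ℝ} (hX : HasMoments P X) (hY : HasMoments P Y) :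
    HasMoments P fun ω => X ω - Y ω := fun p hp => (hX p hp).sub (hY p hp)

lemma HasMoments.mul {X Y : Ω → ℝ} (hX : HasMoments P X) (hY : HasMoments P Y) :
    HasMoments P fun ω => X ω * Y ω := fun p hp => by
  have : ENNReal.HolderTriple (2 * p) (2 * p) p := ⟨by
    rw [ENNReal.mul_inv (Or.inl two_ne_zero) (Or.inl ENNReal.ofNat_ne_top), ← add_mul,
      ENNReal.inv_two_add_inv_two, one_mul]⟩
  exact (hY (2 * p) (ENNReal.mul_ne_top ENNReal.ofNat_ne_top hp)).mul
    (hX (2 * p) (ENNReal.mul_ne_top ENNReal.ofNat_ne_top hp))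

lemma HasMoments.pow [IsFiniteMeasure P] {X : Ω → ℝ} (hX : HasMoments P X) (n : ℕ) :
    HasMoments P fun ω => X ω ^ n := by
  induction n with
  | zero => simpa using HasMoments.const 1
  | succ n ih => simpa [pow_succ] using ih.mul hX

lemma HasMoments.const_mul [IsFiniteMeasure P] {X : Ω → ℝ} (hX : HasMoments P X) (c : ℝ) :
    HasMoments P fun ω => c * X ω := (HasMoments.const c).mul hX

lemma HasMoments.sum {ι : Type*} (s : Finset ι) {X : ι → Ω → ℝ}
    (hX : ∀ i ∈ s, HasMoments P (X i)) : HasMoments P fun ω => ∑ i ∈ s, X i ω :=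
  fun p hp => memLp_finsetSum s fun i hi => hX i hi p hp

lemma HasMoments.integrable {X : Ω → ℝ} (hX : HasMoments P X) : Integrable X P :=
  memLp_one_iff_integrable.1 (hX 1 ENNReal.one_ne_top)

lemma HasMoments.congr {X Y : Ω → ℝ} (hX : HasMoments P X) (h : X =ᵐ[P] Y) :
    HasMoments P Y := fun p hp => (memLp_congr_ae h).1 (hX p hp)

/-- Compare T b² with a². If it is smaller, two factors b are exchanged for two factors a at the
gain 1/T; otherwise factors a are replaced by √T b, or by b when a ≤ b. The scale T balances the two
terms over T steps. -/
lemma pow_mul_pow_le_add {a b T : ℝ} (ha : 0 ≤ a) (hb : 0 ≤ b) (hT : 1 ≤ T) {q j : ℕ}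
    (hj : 2 ≤ j) (hjq : j ≤ 2 * q) :
    b ^ j * a ^ (2 * q - j) ≤ a ^ (2 * q) / T + T ^ (q - 1) * b ^ (2 * q) := by
  obtain ⟨r, rfl⟩ : ∃ r, q = r + 1 := ⟨q - 1, by omega⟩
  obtain ⟨i, rfl⟩ : ∃ i, j = i + 2 := ⟨j - 2, by omega⟩
  have hT0 : 0 < T := by linarith
  have e1 : 2 * (r + 1) - (i + 2) = 2 * r - i := by omega
  have e2 : 2 * (r + 1) = 2 * r + 2 := by ring
  rw [e1, Nat.add_sub_cancel, e2]
  have hA : 0 ≤ a ^ (2 * r + 2) / T := by positivity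
  have hB : 0 ≤ T ^ r * b ^ (2 * r + 2) := by positivity
  rcases le_total (T * b ^ 2) (a ^ 2) with h | h
  · have hba : b ≤ a := by
      apply le_of_sq_le_sq _ ha
      nlinarith [sq_nonneg b]
    have h1 : b ^ (i + 2) * a ^ (2 * r - i) ≤ b ^ 2 * a ^ (2 * r) := by
      calc b ^ (i + 2) * a ^ (2 * r - i) = b ^ i * a ^ (2 * r - i) * b ^ 2 := by ring
        _ ≤ a ^ i * a ^ (2 * r - i) * b ^ 2 := by gcongr
        _ = b ^ 2 * a ^ (2 * r) := by rw [← pow_add, Nat.add_sub_cancel' (by omega)]; ring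
    have h2 : b ^ 2 * a ^ (2 * r) ≤ a ^ (2 * r + 2) / T := by
      rw [le_div_iff₀ hT0]
      calc b ^ 2 * a ^ (2 * r) * T = (T * b ^ 2) * a ^ (2 * r) := by ring
        _ ≤ a ^ 2 * a ^ (2 * r) := by gcongr
        _ = _ := by ring
    linarith
  · have hTr : 1 ≤ T ^ r := one_le_pow₀ hT
    rcases le_total b a with hba | hab
    · have h1 : b ^ (i + 2) * a ^ (2 * r - i) ≤ b ^ 2 * a ^ (2 * r) := by
        calc b ^ (i + 2) * a ^ (2 * r - i) = b ^ i * a ^ (2 * r - i) * b ^ 2 := by ring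
          _ ≤ a ^ i * a ^ (2 * r - i) * b ^ 2 := by gcongr
          _ = b ^ 2 * a ^ (2 * r) := by rw [← pow_add, Nat.add_sub_cancel' (by omega)]; ring
      have h2 : b ^ 2 * a ^ (2 * r) ≤ T ^ r * b ^ (2 * r + 2) := by
        calc b ^ 2 * a ^ (2 * r) = b ^ 2 * (a ^ 2) ^ r := by rw [pow_mul]
          _ ≤ b ^ 2 * (T * b ^ 2) ^ r := by gcongr
          _ = _ := by rw [mul_pow, ← pow_mul]; ring
      linarith
    · have h1 : b ^ (i + 2) * a ^ (2 * r - i) ≤ b ^ (2 * r + 2) := by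
        calc b ^ (i + 2) * a ^ (2 * r - i) ≤ b ^ (i + 2) * b ^ (2 * r - i) := by gcongr
          _ = _ := by rw [← pow_add]; congr 1; omega
      have h2 : b ^ (2 * r + 2) ≤ T ^ r * b ^ (2 * r + 2) :=
        le_mul_of_one_le_left (by positivity) hTr
      linarith

/-- In the binomial expansion the linear term is kept exact, to vanish in expectation; all terms of
order at least two in d share one bound, and their coefficients sum to at most 4^q. -/
lemma add_pow_two_mul_le (s d : ℝ) {T : ℝ} (hT : 1 ≤ T) {q : ℕ} (hq : 1 ≤ q) :
    (s + d) ^ (2 * q) ≤ s ^ (2 * q) + 2 * q * (s ^ (2 * q - 1) * d)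
      + 4 ^ q * (s ^ (2 * q) / T + T ^ (q - 1) * d ^ (2 * q)) := by
  obtain ⟨r, hr⟩ : ∃ r, 2 * q = r + 2 := ⟨2 * q - 2, by omega⟩
  have hev : Even (2 * q) := even_two_mul q
  have hterm : ∀ m ∈ Finset.range (r + 1), d ^ (m + 2) * s ^ (2 * q - (m + 2)) *
      ((2 * q).choose (m + 2) : ℝ) ≤
        (s ^ (2 * q) / T + T ^ (q - 1) * d ^ (2 * q)) * ((2 * q).choose (m + 2) : ℝ) := by
    intro m hm
    rw [Finset.mem_range] at hm
    refine mul_le_mul_of_nonneg_right ?_ (by positivity)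
    have := pow_mul_pow_le_add (abs_nonneg s) (abs_nonneg d) hT (q := q) (j := m + 2) (by omega)
      (by omega)
    rw [hev.pow_abs, hev.pow_abs, ← abs_pow, ← abs_pow, ← abs_mul] at this
    exact (le_abs_self _).trans this
  have hnn : 0 ≤ s ^ (2 * q) / T + T ^ (q - 1) * d ^ (2 * q) := by
    have := hev.pow_nonneg s
    have := hev.pow_nonneg d
    positivity
  have hchoose : ∑ m ∈ Finset.range (r + 1), ((2 * q).choose (m + 2) : ℝ) ≤ 4 ^ q := by
    have h1 := Nat.sum_range_choose (2 * q)
    rw [show 2 * q + 1 = (r + 1) + 1 + 1 by omega, Finset.sum_range_succ',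
      Finset.sum_range_succ', pow_mul] at h1
    have h2 : ∑ m ∈ Finset.range (r + 1), (2 * q).choose (m + 2) ≤ 4 ^ q := by
      have : (2 ^ 2) ^ q = 4 ^ q := by norm_num
      simp only [add_assoc, Nat.reduceAdd] at h1
      omega
    exact_mod_cast h2
  have hsum := Finset.sum_le_sum hterm
  rw [← Finset.mul_sum] at hsum
  have hfin := hsum.trans (mul_le_mul_of_nonneg_left hchoose hnn)
  rw [add_comm s d, add_pow, show 2 * q + 1 = (r + 1) + 1 + 1 by omega, Finset.sum_range_succ',
    Finset.sum_range_succ']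
  simp only [add_assoc, Nat.reduceAdd, zero_add, pow_zero, pow_one, Nat.choose_zero_right,
    Nat.choose_one_right, Nat.sub_zero] at hfin ⊢
  push_cast at hfin ⊢
  linarith

/-- A moment inequality of Marcinkiewicz–Zygmund type: if the increments `D k` have bounded
moments of order `2 q`, and are orthogonal to the odd powers of the preceding partial sums, then
the moment of order `2 q` of the sum of `T` increments is of order `T ^ q`. -/
lemma integral_sum_pow_le [IsProbabilityMeasure P] (D : ℕ → Ω → ℝ) (hD : ∀ k, HasMoments P (D k))
    {q : ℕ} (hq : 1 ≤ q)
    (horth : ∀ k, ∫ ω, (∑ l ∈ Finset.range k, D l ω) ^ (2 * q - 1) * D k ω ∂P = 0)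
    {M : ℝ} (hM : ∀ k, ∫ ω, D k ω ^ (2 * q) ∂P ≤ M) (T : ℕ) :
    ∫ ω, (∑ l ∈ Finset.range T, D l ω) ^ (2 * q) ∂P
      ≤ 4 ^ q * Real.exp (4 ^ q) * M * (T : ℝ) ^ q := by
  rcases Nat.eq_zero_or_pos T with rfl | hT
  · have : 2 * q ≠ 0 := by omega
    simp [this, show q ≠ 0 by omega]
  have hTr : (1 : ℝ) ≤ T := by exact_mod_cast hT
  have hM0 : 0 ≤ M := le_trans
    (integral_nonneg fun ω => (even_two_mul q).pow_nonneg (D 0 ω)) (hM 0)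
  have hS : ∀ k, HasMoments P fun ω => ∑ l ∈ Finset.range k, D l ω :=
    fun k => HasMoments.sum _ fun l _ => hD l
  -- The recursion for the moments is E S_{k+1}^{2q} ≤ A E S_k^{2q} + c. Over T steps A^T stays
  -- below exp(4^q), and T c is of order T^q.
  set A : ℝ := 1 + 4 ^ q / T with hA
  have hA1 : 1 ≤ A := by
    have : (0 : ℝ) ≤ 4 ^ q / T := by positivity
    linarith
  set c : ℝ := 4 ^ q * (T ^ (q - 1) * M) with hc
  have hc0 : 0 ≤ c := by positivity
  have hind : ∀ k, ∫ ω, (∑ l ∈ Finset.range k, D l ω) ^ (2 * q) ∂P ≤ A ^ k * (k * c) := by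
    intro k
    induction k with
    | zero =>
      have : 2 * q ≠ 0 := by omega
      simp [this]
    | succ k ih =>
      have i1 := ((hS k).pow (2 * q)).integrable
      have i2 := (((hS k).pow (2 * q - 1)).mul (hD k)).integrable
      have i3 := ((hD k).pow (2 * q)).integrable
      have h1 : ∫ ω, (∑ l ∈ Finset.range (k + 1), D l ω) ^ (2 * q) ∂P ≤
          ∫ ω, ((∑ l ∈ Finset.range k, D l ω) ^ (2 * q)
            + 2 * q * ((∑ l ∈ Finset.range k, D l ω) ^ (2 * q - 1) * D k ω)
            + 4 ^ q * ((∑ l ∈ Finset.range k, D l ω) ^ (2 * q) / T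
              + T ^ (q - 1) * D k ω ^ (2 * q))) ∂P := by
        refine integral_mono ((hS (k + 1)).pow (2 * q)).integrable ?_ fun ω => ?_
        · exact (i1.add (i2.const_mul _)).add (((i1.div_const _).add (i3.const_mul _)).const_mul _)
        · simp only [Finset.sum_range_succ]
          exact add_pow_two_mul_le _ _ hTr hq
      rw [integral_add (by exact i1.add (i2.const_mul _))
        (by exact ((i1.div_const _).add (i3.const_mul _)).const_mul _),
        integral_add i1 (i2.const_mul _), integral_const_mul, integral_const_mul,
        integral_add (i1.div_const _) (i3.const_mul _), integral_div, integral_const_mul,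
        horth k] at h1
      have h2 : (4 : ℝ) ^ q * (T ^ (q - 1) * ∫ ω, D k ω ^ (2 * q) ∂P) ≤ c := by
        rw [hc]; gcongr; exact hM k
      have h3 : (1 : ℝ) ≤ A ^ (k + 1) := one_le_pow₀ hA1
      have h4 : A * ∫ ω, (∑ l ∈ Finset.range k, D l ω) ^ (2 * q) ∂P ≤ A * (A ^ k * (k * c)) := by
        gcongr
      have h5 : c ≤ A ^ (k + 1) * c := le_mul_of_one_le_left hc0 h3
      push_cast
      rw [pow_succ] at h5 ⊢
      have h6 : A * ∫ ω, (∑ l ∈ Finset.range k, D l ω) ^ (2 * q) ∂P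
          = ∫ ω, (∑ l ∈ Finset.range k, D l ω) ^ (2 * q) ∂P
            + 4 ^ q * ((∫ ω, (∑ l ∈ Finset.range k, D l ω) ^ (2 * q) ∂P) / T) := by
        rw [hA]; ring
      linarith
  refine (hind T).trans ?_
  have hexp : A ^ T ≤ Real.exp (4 ^ q) := by
    have h1 : A ≤ Real.exp (4 ^ q / T) := by
      rw [hA, add_comm]; exact Real.add_one_le_exp _
    calc A ^ T ≤ Real.exp (4 ^ q / T) ^ T := by gcongr
      _ = Real.exp (4 ^ q) := by rw [← Real.exp_nat_mul]; congr 1; field_simp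
  have e : (T : ℝ) * c = 4 ^ q * M * T ^ q := by
    rw [hc]
    obtain ⟨r, rfl⟩ : ∃ r, q = r + 1 := ⟨q - 1, by omega⟩
    rw [Nat.add_sub_cancel]; ring
  rw [e]
  calc A ^ T * (4 ^ q * M * T ^ q) ≤ Real.exp (4 ^ q) * (4 ^ q * M * T ^ q) := by gcongr
    _ = _ := by ring

/-- Jensen's inequality for a finite positive combination and an even power. -/
lemma sum_mul_pow_le {ι : Type*} (s : Finset ι) (a x : ι → ℝ) (ha : ∀ i ∈ s, 0 < a i) {n : ℕ}
    (hn : Even n) (hn0 : n ≠ 0) :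
    (∑ i ∈ s, a i * x i) ^ n ≤ (∑ i ∈ s, a i) ^ (n - 1) * ∑ i ∈ s, a i * x i ^ n := by
  rcases s.eq_empty_or_nonempty with rfl | hs
  · simp [hn0]
  have hA : 0 < ∑ i ∈ s, a i := Finset.sum_pos ha hs
  set A := ∑ i ∈ s, a i with hAdef
  have := Real.pow_arith_mean_le_arith_mean_pow_of_even s (fun i => a i / A) x
    (fun i hi => (div_pos (ha i hi) hA).le) (by rw [← Finset.sum_div, ← hAdef, div_self hA.ne']) hn
  have e1 : ∑ i ∈ s, a i / A * x i = (∑ i ∈ s, a i * x i) / A := by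
    rw [Finset.sum_div]; exact Finset.sum_congr rfl fun i _ => by ring
  have e2 : ∑ i ∈ s, a i / A * x i ^ n = (∑ i ∈ s, a i * x i ^ n) / A := by
    rw [Finset.sum_div]; exact Finset.sum_congr rfl fun i _ => by ring
  rw [e1, e2, div_pow, div_le_div_iff₀ (by positivity) hA] at this
  obtain ⟨r, rfl⟩ : ∃ r, n = r + 1 := ⟨n - 1, by omega⟩
  rw [Nat.add_sub_cancel]
  refine le_of_mul_le_mul_right ?_ hA
  calc _ ≤ _ := this
    _ = _ := by ring

end Moments

/-! ### Noise products as martingale increments. -/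

section Noise

/-- The σ-algebra generated by the noise before time `t`. -/
@[reducible] def noisePast {Ω : Type*} (e : ℕ → Ω → ℝ) (t : ℕ) : MeasurableSpace Ω :=
  ⨆ l ∈ Set.Iio t, MeasurableSpace.comap (e l) inferInstance

lemma noisePast_mono {Ω : Type*} (e : ℕ → Ω → ℝ) {s t : ℕ} (hst : s ≤ t) :
    noisePast e s ≤ noisePast e t :=
  biSup_mono fun _ h => lt_of_lt_of_le h hst

lemma measurable_noisePast {Ω : Type*} (e : ℕ → Ω → ℝ) {l t : ℕ} (h : l < t) :
    Measurable[noisePast e t] (e l) :=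
  Measurable.mono (comap_measurable (e l))
    (le_biSup (fun l => MeasurableSpace.comap (e l) inferInstance) h) le_rfl

variable {Ω : Type*} [MeasurableSpace Ω] {P : Measure Ω}

/-- The noise is only almost everywhere measurable; the σ-algebras of its past must lie in the
ambient one, so a measurable version is used. -/
lemma IsDrivingNoise.exists_measurable {e : ℕ → Ω → ℝ} {δ : ℝ} (h : IsDrivingNoise P e δ) :
    ∃ e' : ℕ → Ω → ℝ, (∀ k, Measurable (e' k)) ∧ IsDrivingNoise P e' δ ∧
      ∀ k, e k =ᵐ[P] e' k := by
  have hm : ∀ k, AEMeasurable (e k) P := fun k => (h.memLp k 0).aestronglyMeasurable.aemeasurable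
  have hae : ∀ k, e k =ᵐ[P] (hm k).mk (e k) := fun k => (hm k).ae_eq_mk
  refine ⟨fun k => (hm k).mk (e k), fun k => (hm k).measurable_mk, ?_, hae⟩
  constructor
  · exact h.indep.congr hae
  · exact fun k q => (memLp_congr_ae (hae k)).1 (h.memLp k q)
  · exact fun k => (integral_congr_ae (hae k)).symm.trans (h.mean_zero k)
  · exact fun k => (variance_congr (hae k)).symm.trans (h.variance_eq k)
  · intro q
    obtain ⟨C, hC⟩ := h.moments q
    refine ⟨C, fun k => le_trans (le_of_eq (integral_congr_ae ?_)) (hC k)⟩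
    filter_upwards [hae k] with ω hω
    rw [hω]

variable {e : ℕ → Ω → ℝ} {δ : ℝ}

lemma IsDrivingNoise.hasMoments [IsProbabilityMeasure P] (h : IsDrivingNoise P e δ) (k : ℕ) :
    HasMoments P (e k) := HasMoments.of_nat fun q => h.memLp k q

lemma IsDrivingNoise.integral_sq [IsProbabilityMeasure P] (h : IsDrivingNoise P e δ) (k : ℕ) :
    ∫ ω, e k ω * e k ω ∂P = δ ^ 2 := by
  rw [← h.variance_eq k, variance_eq_sub (by simpa using h.memLp k 2), h.mean_zero k]
  simp [sq]

lemma IsDrivingNoise.integral_mul_of_ne (h : IsDrivingNoise P e δ) {k l : ℕ} (hkl : k ≠ l) :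
    ∫ ω, e k ω * e l ω ∂P = 0 := by
  rw [(h.indep.indepFun hkl).integral_fun_mul_eq_mul_integral
    (h.memLp k 0).aestronglyMeasurable (h.memLp l 0).aestronglyMeasurable, h.mean_zero, zero_mul]

lemma noisePast_le (he : ∀ k, Measurable (e k)) (t : ℕ) :
    noisePast e t ≤ (inferInstance : MeasurableSpace Ω) :=
  iSup₂_le fun l _ => (he l).comap_le

/-- A function of the past times a centred function of the present noise has mean zero. -/
lemma integral_mul_eq_zero_of_noisePast (he : ∀ k, Measurable (e k)) (h : IsDrivingNoise P e δ)
    {t : ℕ} {X : Ω → ℝ} (hX : Measurable[noisePast e t] X) {g : ℝ → ℝ} (hg : Measurable g)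
    (h0 : ∫ ω, g (e t ω) ∂P = 0) : ∫ ω, X ω * g (e t ω) ∂P = 0 := by
  have hind := indep_iSup_of_disjoint (fun k => (he k).comap_le) h.indep
    (S := Set.Iio t) (T := {t}) (by simp)
  rw [iSup_singleton] at hind
  have hXe : IndepFun X (e t) P := by
    rw [IndepFun_iff_Indep]
    exact indep_of_indep_of_le_left hind hX.comap_le
  have hXg : IndepFun X (fun ω => g (e t ω)) P := hXe.comp measurable_id hg
  have hX' : Measurable X := hX.mono (noisePast_le he t) le_rfl
  rw [hXg.integral_fun_mul_eq_mul_integral hX'.aestronglyMeasurable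
    (hg.comp (he t)).aestronglyMeasurable, h0, mul_zero]

/-- Moment bound for sums of martingale increments, each a product of a function of the noise
before time `k - i` and a centred function of the noise at time `k - i`. -/
lemma integral_delayed_sum_pow_le [IsProbabilityMeasure P] (he : ∀ k, Measurable (e k))
    (h : IsDrivingNoise P e δ) (i : ℕ) (D : ℕ → Ω → ℝ) (hDm : ∀ k, HasMoments P (D k))
    (hD : ∀ k, (∀ ω, D k ω = 0) ∨ (i ≤ k ∧ ∃ (Y : Ω → ℝ) (g : ℝ → ℝ),
      Measurable[noisePast e (k - i)] Y ∧ Measurable g ∧ ∫ ω, g (e (k - i) ω) ∂P = 0 ∧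
      ∀ ω, D k ω = Y ω * g (e (k - i) ω)))
    {q : ℕ} (hq : 1 ≤ q) {M : ℝ} (hM : ∀ k, ∫ ω, D k ω ^ (2 * q) ∂P ≤ M) (T : ℕ) :
    ∫ ω, (∑ l ∈ Finset.range T, D l ω) ^ (2 * q) ∂P
      ≤ 4 ^ q * Real.exp (4 ^ q) * M * (T : ℝ) ^ q := by
  refine integral_sum_pow_le D hDm hq (fun k => ?_) hM T
  rcases hD k with h0 | ⟨hik, Y, g, hY, hg, hg0, hYg⟩
  · simp [h0]
  -- Earlier nonzero increments involve noise only up to time l - i < k - i, so powers of the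
  -- partial sum can be absorbed into the past factor Y.
  have hS : Measurable[noisePast e (k - i)] fun ω => ∑ l ∈ Finset.range k, D l ω := by
    refine Finset.measurable_fun_sum _ fun l hl => ?_
    rw [Finset.mem_range] at hl
    rcases hD l with h0 | ⟨hil, Y', g', hY', hg', -, hYg'⟩
    · have : D l = fun _ => 0 := funext h0
      rw [this]; exact measurable_const
    · have : D l = fun ω => Y' ω * g' (e (l - i) ω) := funext hYg'
      rw [this]
      exact (hY'.mono (noisePast_mono e (by omega)) le_rfl).mul
        (hg'.comp (measurable_noisePast e (by omega)))
  have := integral_mul_eq_zero_of_noisePast he h ((hS.pow_const (2 * q - 1)).mul hY) hg hg0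
  rw [← this]
  refine integral_congr_ae (ae_of_all _ fun ω => ?_)
  simp only [Pi.mul_apply, hYg]
  ring

/-- The variable multiplying the `i`-th filter coefficient at time `k`: the constant `1` for
`i = 0`, and the noise with delay `i - 1` otherwise. -/
def lagVar (e : ℕ → Ω → ℝ) (k : ℕ) : ℕ → Ω → ℝ
  | 0 => fun _ => 1
  | i + 1 => e (k - i)

lemma hasMoments_lagVar [IsProbabilityMeasure P] (h : IsDrivingNoise P e δ) (k i : ℕ) :
    HasMoments P (lagVar e k i) := by
  cases i with
  | zero => exact HasMoments.const 1
  | succ i => exact h.hasMoments _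

lemma integral_lagVar_pow_le [IsProbabilityMeasure P] (h : IsDrivingNoise P e δ) (q : ℕ) :
    ∃ C : ℝ, 0 ≤ C ∧ ∀ k i, ∫ ω, lagVar e k i ω ^ (2 * q) ∂P ≤ C := by
  obtain ⟨C, hC⟩ := h.moments (2 * q)
  refine ⟨max C 1, by positivity, fun k i => ?_⟩
  cases i with
  | zero => simp [lagVar]
  | succ i =>
    refine le_trans (le_of_eq ?_) ((hC (k - i)).trans (le_max_left _ _))
    exact integral_congr_ae (ae_of_all _ fun ω => ((even_two_mul q).pow_abs _).symm)

/-- The centred product of two lagged variables. -/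
noncomputable def lagProd (P : Measure Ω) (e : ℕ → Ω → ℝ) (k i j : ℕ) (ω : Ω) : ℝ :=
  lagVar e k i ω * lagVar e k j ω - ∫ ω, lagVar e k i ω * lagVar e k j ω ∂P

lemma hasMoments_lagProd [IsProbabilityMeasure P] (h : IsDrivingNoise P e δ) (k i j : ℕ) :
    HasMoments P (lagProd P e k i j) :=
  ((hasMoments_lagVar h k i).mul (hasMoments_lagVar h k j)).sub (HasMoments.const _)

lemma lagProd_comm (k i j : ℕ) (ω : Ω) : lagProd P e k i j ω = lagProd P e k j i ω := by
  simp only [lagProd, mul_comm]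

lemma sub_pow_two_mul_le (x y : ℝ) (q : ℕ) :
    (x - y) ^ (2 * q) ≤ 4 ^ q * (x ^ (2 * q) + y ^ (2 * q)) := by
  have h1 : (x - y) ^ 2 ≤ 4 * max (x ^ 2) (y ^ 2) := by
    have := le_max_left (x ^ 2) (y ^ 2)
    have := le_max_right (x ^ 2) (y ^ 2)
    nlinarith [sq_nonneg (x + y)]
  rw [pow_mul, pow_mul, pow_mul]
  calc ((x - y) ^ 2) ^ q ≤ (4 * max (x ^ 2) (y ^ 2)) ^ q := by gcongr
    _ = 4 ^ q * (max (x ^ 2) (y ^ 2)) ^ q := mul_pow _ _ _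
    _ ≤ _ := by
      gcongr
      rcases max_cases (x ^ 2) (y ^ 2) with ⟨h, -⟩ | ⟨h, -⟩ <;> rw [h]
      · have : 0 ≤ (y ^ 2) ^ q := by positivity
        linarith
      · have : 0 ≤ (x ^ 2) ^ q := by positivity
        linarith

lemma integral_lagProd_pow_le [IsProbabilityMeasure P] (h : IsDrivingNoise P e δ) (q : ℕ) :
    ∃ C : ℝ, 0 ≤ C ∧ ∀ k i j, ∫ ω, lagProd P e k i j ω ^ (2 * q) ∂P ≤ C := by
  obtain ⟨C₁, hC₁0, hC₁⟩ := integral_lagVar_pow_le h 1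
  obtain ⟨C, hC0, hC⟩ := integral_lagVar_pow_le h (2 * q)
  refine ⟨4 ^ q * (C + C₁ ^ (2 * q)), by positivity, fun k i j => ?_⟩
  have hi := hasMoments_lagVar h k i
  have hj := hasMoments_lagVar h k j
  have hmean : |∫ ω, lagVar e k i ω * lagVar e k j ω ∂P| ≤ C₁ := by
    refine (abs_integral_le_integral_abs).trans ?_
    calc ∫ ω, |lagVar e k i ω * lagVar e k j ω| ∂P
        ≤ ∫ ω, (lagVar e k i ω ^ (2 * 1) / 2 + lagVar e k j ω ^ (2 * 1) / 2) ∂P := by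
          refine integral_mono (hi.mul hj).integrable.abs
            (((hi.pow _).integrable.div_const _).add ((hj.pow _).integrable.div_const _))
            fun ω => ?_
          simp only [mul_one]
          rw [abs_le]
          constructor <;> nlinarith [sq_nonneg (lagVar e k i ω + lagVar e k j ω),
            sq_nonneg (lagVar e k i ω - lagVar e k j ω)]
      _ ≤ C₁ := by
          rw [integral_add ((hi.pow _).integrable.div_const _) ((hj.pow _).integrable.div_const _),
            integral_div, integral_div]
          linarith [hC₁ k i, hC₁ k j]
  set m := ∫ ω, lagVar e k i ω * lagVar e k j ω ∂P
  have hmq : m ^ (2 * q) ≤ C₁ ^ (2 * q) := by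
    rw [← (even_two_mul q).pow_abs]
    exact pow_le_pow_left₀ (abs_nonneg _) hmean _
  calc ∫ ω, lagProd P e k i j ω ^ (2 * q) ∂P
      ≤ ∫ ω, 4 ^ q * ((lagVar e k i ω ^ (2 * (2 * q)) / 2 + lagVar e k j ω ^ (2 * (2 * q)) / 2)
          + C₁ ^ (2 * q)) ∂P := by
        refine integral_mono ((hasMoments_lagProd h k i j).pow _).integrable
          (((((hi.pow _).integrable.div_const _).add
            ((hj.pow _).integrable.div_const _)).add (integrable_const _)).const_mul _)
          fun ω => (sub_pow_two_mul_le _ _ q).trans ?_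
        gcongr
        rw [mul_pow, mul_comm 2 (2 * q), pow_mul _ (2 * q) 2, pow_mul _ (2 * q) 2]
        nlinarith [sq_nonneg (lagVar e k i ω ^ (2 * q) - lagVar e k j ω ^ (2 * q))]
    _ ≤ _ := by
        rw [integral_const_mul, integral_add (by
          exact ((hi.pow _).integrable.div_const _).add ((hj.pow _).integrable.div_const _))
          (integrable_const _), integral_add ((hi.pow _).integrable.div_const _)
          ((hj.pow _).integrable.div_const _), integral_div, integral_div]
        simp only [integral_const, probReal_univ, one_smul]
        gcongr
        linarith [hC k i, hC k j]

/-- With i ≤ j the newest noise is that of time k - i. On the diagonal its centred square is the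
increment; off the diagonal the older factor goes into Y. -/
lemma lagProd_increment [IsProbabilityMeasure P] (h : IsDrivingNoise P e δ) {i j k : ℕ}
    (hij : i ≤ j) (hj : j ≤ k) (c : ℝ) :
    ∃ (Y : Ω → ℝ) (g : ℝ → ℝ),
      Measurable[noisePast e (k - i)] Y ∧ Measurable g ∧ ∫ ω, g (e (k - i) ω) ∂P = 0 ∧
      ∀ ω, c * lagProd P e k (i + 1) (j + 1) ω = Y ω * g (e (k - i) ω) := by
  rcases hij.eq_or_lt with rfl | hij
  · refine ⟨fun _ => c, fun x => x * x - δ ^ 2, measurable_const, by fun_prop, ?_, fun ω => ?_⟩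
    · have := (h.hasMoments (k - i)).mul (h.hasMoments (k - i))
      rw [integral_sub this.integrable (integrable_const _), h.integral_sq]
      simp
    · simp only [lagProd, lagVar]
      rw [h.integral_sq]
  · refine ⟨fun ω => c * e (k - j) ω, id, ?_, measurable_id, h.mean_zero _, fun ω => ?_⟩
    · exact (measurable_noisePast e (by omega)).const_mul c
    · simp only [lagProd, lagVar, id]
      rw [h.integral_mul_of_ne (by omega)]
      ring

/-- Moment bound for the sums of centred products with two fixed lags, uniformly in the lags and
in the weights. -/
lemma integral_lagProd_sum_pow_le [IsProbabilityMeasure P] (he : ∀ k, Measurable (e k))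
    (h : IsDrivingNoise P e δ) {q : ℕ} (hq : 1 ≤ q) :
    ∃ C : ℝ, 0 ≤ C ∧ ∀ (i j : ℕ) (w : ℕ → ℝ), (∀ k, |w k| ≤ 1) →
      (∀ k, k + 1 < i ∨ k + 1 < j → w k = 0) → ∀ T : ℕ,
      ∫ ω, (∑ k ∈ Finset.range T, w k * lagProd P e k i j ω) ^ (2 * q) ∂P ≤ C * (T : ℝ) ^ q := by
  obtain ⟨M, hM0, hM⟩ := integral_lagProd_pow_le h q
  refine ⟨4 ^ q * Real.exp (4 ^ q) * M, by positivity, ?_⟩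
  intro i j
  wlog hij : i ≤ j generalizing i j
  · intro w hw hw0 T
    simp only [lagProd_comm _ i j]
    exact this j i (by omega) w hw (fun k hk => hw0 k hk.symm) T
  intro w hw hw0 T
  have hDm : ∀ k, HasMoments P fun ω => w k * lagProd P e k i j ω :=
    fun k => (hasMoments_lagProd h k i j).const_mul _
  have hDM : ∀ k, ∫ ω, (w k * lagProd P e k i j ω) ^ (2 * q) ∂P ≤ M := by
    intro k
    refine le_trans (integral_mono ((hDm k).pow _).integrable
      ((hasMoments_lagProd h k i j).pow _).integrable fun ω => ?_) (hM k i j)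
    dsimp only
    rw [mul_pow]
    refine mul_le_of_le_one_left ((even_two_mul q).pow_nonneg _) ?_
    rw [← (even_two_mul q).pow_abs]
    exact pow_le_one₀ (abs_nonneg _) (hw k)
  -- The delay of the newest noise in the product; index 0 is the constant 1, leaving only the
  -- factor of index j. Vanishing weights at early times exclude the truncated `k - i`, which would
  -- repeat `e 0`.
  refine integral_delayed_sum_pow_le he h (if i = 0 then j - 1 else i - 1) _ hDm (fun k => ?_) hq
    hDM T
  by_cases hk : k + 1 < i ∨ k + 1 < j
  · exact Or.inl fun ω => by rw [hw0 k hk, zero_mul]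
  push Not at hk
  match i, j with
  | 0, 0 => exact Or.inl fun ω => by simp [lagProd, lagVar]
  | 0, j + 1 =>
    refine Or.inr ⟨by simp; omega, fun _ => w k, id, measurable_const, measurable_id, ?_, ?_⟩
    · simpa using h.mean_zero (k - j)
    · intro ω
      simp [lagProd, lagVar, h.mean_zero]
  | i + 1, 0 => omega
  | i + 1, j + 1 =>
    rw [show (if i + 1 = 0 then j + 1 - 1 else i + 1 - 1) = i by simp]
    refine Or.inr ⟨by omega, ?_⟩
    exact lagProd_increment h (by omega : i ≤ j) (by omega : j ≤ k) (w k)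

end Noise

/-! ### Moment bounds for filtered noise. -/

section Filters

variable {Ω : Type*} [MeasurableSpace Ω] {P : Measure Ω} {e : ℕ → Ω → ℝ} {δ : ℝ}

/-- Causal filter coefficients, time-varying and dominated by a summable sequence. -/
structure IsStableFilter (c : ℕ → ℕ → ℝ) : Prop where
  dominated : ∃ g : ℕ → ℝ, (∀ i, 0 < g i) ∧ Summable g ∧ ∀ k i, |c k i| ≤ g i
  causal : ∀ k i, k + 1 < i → c k i = 0

/-- The output of a filter at time `k`; the coefficient of index `0` is the mean of the output,
and the coefficient of index `i + 1` is multiplied with the noise with delay `i`. -/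
noncomputable def filterOutput {Ω : Type*} (e : ℕ → Ω → ℝ) (c : ℕ → ℕ → ℝ) (k : ℕ) (ω : Ω) : ℝ :=
  ∑ i ∈ Finset.range (k + 2), c k i * lagVar e k i ω

lemma IsStableFilter.filterOutput_eq {Ω : Type*} {e : ℕ → Ω → ℝ} {c : ℕ → ℕ → ℝ}
    (hc : IsStableFilter c) {k n : ℕ} (hn : k + 2 ≤ n) (ω : Ω) :
    filterOutput e c k ω = ∑ i ∈ Finset.range n, c k i * lagVar e k i ω := by
  refine Finset.sum_subset (by simpa using hn) fun i _ hi => ?_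
  rw [hc.causal k i (by simp at hi; omega), zero_mul]

lemma hasMoments_filterOutput [IsProbabilityMeasure P] (h : IsDrivingNoise P e δ)
    (c : ℕ → ℕ → ℝ) (k : ℕ) : HasMoments P (filterOutput e c k) :=
  HasMoments.sum _ fun i _ => (hasMoments_lagVar h k i).const_mul _

/-- Jensen's inequality: only the total weight matters, not the number of terms, and no independence
between the terms is needed. -/
lemma integral_weighted_sum_pow_le [IsProbabilityMeasure P] {ι : Type*} (s : Finset ι) (a : ι → ℝ)
    (ha : ∀ i ∈ s, 0 < a i) {A : ℝ} (hA : ∑ i ∈ s, a i ≤ A) (X : ι → Ω → ℝ)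
    (hX : ∀ i ∈ s, HasMoments P (X i)) {q : ℕ} (hq : 1 ≤ q) {M : ℝ} (hM : 0 ≤ M)
    (hXM : ∀ i ∈ s, ∫ ω, X i ω ^ (2 * q) ∂P ≤ M) :
    ∫ ω, (∑ i ∈ s, a i * X i ω) ^ (2 * q) ∂P ≤ A ^ (2 * q) * M := by
  have hA0 : 0 ≤ ∑ i ∈ s, a i := Finset.sum_nonneg fun i hi => (ha i hi).le
  calc ∫ ω, (∑ i ∈ s, a i * X i ω) ^ (2 * q) ∂P
      ≤ ∫ ω, (∑ i ∈ s, a i) ^ (2 * q - 1) * ∑ i ∈ s, a i * X i ω ^ (2 * q) ∂P := by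
        refine integral_mono ((HasMoments.sum s fun i hi => (hX i hi).const_mul _).pow _).integrable
          ?_ fun ω => sum_mul_pow_le s a (fun i => X i ω) ha (even_two_mul q) (by omega)
        exact ((HasMoments.sum s fun i hi => ((hX i hi).pow _).const_mul _).const_mul _).integrable
    _ = (∑ i ∈ s, a i) ^ (2 * q - 1) * ∑ i ∈ s, a i * ∫ ω, X i ω ^ (2 * q) ∂P := by
        rw [integral_const_mul, integral_finsetSum _
          fun i hi => (((hX i hi).pow _).const_mul _).integrable]
        simp only [integral_const_mul]
    _ ≤ (∑ i ∈ s, a i) ^ (2 * q - 1) * ∑ i ∈ s, a i * M := by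
        gcongr with i hi
        · exact (ha i hi).le
        · exact hXM i hi
    _ = (∑ i ∈ s, a i) ^ (2 * q) * M := by
        rw [← Finset.sum_mul, ← mul_assoc, ← pow_succ]
        congr 2; omega
    _ ≤ _ := by gcongr

lemma integral_filterOutput_pow_le [IsProbabilityMeasure P] (h : IsDrivingNoise P e δ)
    {c : ℕ → ℕ → ℝ} (hc : IsStableFilter c) {q : ℕ} (hq : 1 ≤ q) :
    ∃ C : ℝ, 0 ≤ C ∧ ∀ k, ∫ ω, filterOutput e c k ω ^ (2 * q) ∂P ≤ C := by
  obtain ⟨g, hg0, hgs, hg⟩ := hc.dominated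
  obtain ⟨M, hM0, hM⟩ := integral_lagVar_pow_le h q
  refine ⟨(∑' i, g i) ^ (2 * q) * M, by
    have : 0 ≤ ∑' i, g i := tsum_nonneg fun i => (hg0 i).le
    positivity, fun k => ?_⟩
  have e1 : ∀ ω, filterOutput e c k ω
      = ∑ i ∈ Finset.range (k + 2), g i * (c k i / g i * lagVar e k i ω) := fun ω => by
    refine Finset.sum_congr rfl fun i _ => ?_
    have := (hg0 i).ne'
    field_simp
  simp only [e1]
  refine integral_weighted_sum_pow_le _ g (fun i _ => hg0 i)
    (hgs.sum_le_tsum _ fun i _ => (hg0 i).le) _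
    (fun i _ => (hasMoments_lagVar h k i).const_mul _) hq hM0 fun i _ => ?_
  refine le_trans (integral_mono (((hasMoments_lagVar h k i).const_mul _).pow _).integrable
    ((hasMoments_lagVar h k i).pow _).integrable fun ω => ?_) (hM k i)
  dsimp only
  rw [mul_pow]
  refine mul_le_of_le_one_left ((even_two_mul q).pow_nonneg _) ?_
  rw [← (even_two_mul q).pow_abs]
  refine pow_le_one₀ (abs_nonneg _) ?_
  rw [abs_div, abs_of_pos (hg0 i), div_le_one (hg0 i)]
  exact hg k i

lemma filterOutput_mul_sub_integral [IsProbabilityMeasure P] (h : IsDrivingNoise P e δ)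
    {c c' : ℕ → ℕ → ℝ} (hc : IsStableFilter c) (hc' : IsStableFilter c') {k n : ℕ}
    (hn : k + 2 ≤ n) (ω : Ω) :
    filterOutput e c k ω * filterOutput e c' k ω
        - ∫ ω, filterOutput e c k ω * filterOutput e c' k ω ∂P
      = ∑ x ∈ Finset.range n ×ˢ Finset.range n, c k x.1 * c' k x.2 * lagProd P e k x.1 x.2 ω := by
  have e1 : ∀ ω, filterOutput e c k ω * filterOutput e c' k ω
      = ∑ x ∈ Finset.range n ×ˢ Finset.range n,
        c k x.1 * c' k x.2 * (lagVar e k x.1 ω * lagVar e k x.2 ω) := fun ω => by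
    rw [hc.filterOutput_eq hn, hc'.filterOutput_eq hn, Finset.sum_mul_sum, Finset.sum_product]
    exact Finset.sum_congr rfl fun i _ => Finset.sum_congr rfl fun j _ => by ring
  simp only [e1]
  rw [integral_finsetSum _ fun x _ =>
    (((hasMoments_lagVar h k x.1).mul (hasMoments_lagVar h k x.2)).const_mul _).integrable,
    ← Finset.sum_sub_distrib]
  refine Finset.sum_congr rfl fun x _ => ?_
  rw [integral_const_mul, lagProd, mul_sub]

/-- The sums of centred products of two filter outputs satisfy the moment bounds of sums of
independent variables. -/
lemma integral_sum_filterOutput_mul_pow_le [IsProbabilityMeasure P] (he : ∀ k, Measurable (e k))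
    (h : IsDrivingNoise P e δ) {c c' : ℕ → ℕ → ℝ} (hc : IsStableFilter c)
    (hc' : IsStableFilter c') {q : ℕ} (hq : 1 ≤ q) :
    ∃ C : ℝ, 0 ≤ C ∧ ∀ T : ℕ,
      ∫ ω, (∑ k ∈ Finset.range T, (filterOutput e c k ω * filterOutput e c' k ω
        - ∫ ω, filterOutput e c k ω * filterOutput e c' k ω ∂P)) ^ (2 * q) ∂P ≤ C * (T : ℝ) ^ q := by
  obtain ⟨g, hg0, hgs, hg⟩ := hc.dominated
  obtain ⟨g', hg0', hgs', hg'⟩ := hc'.dominated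
  obtain ⟨M, hM0, hM⟩ := integral_lagProd_sum_pow_le he h hq
  have hG : 0 ≤ ∑' i, g i := tsum_nonneg fun i => (hg0 i).le
  have hG' : 0 ≤ ∑' i, g' i := tsum_nonneg fun i => (hg0' i).le
  refine ⟨((∑' i, g i) * ∑' i, g' i) ^ (2 * q) * M, by positivity, fun T => ?_⟩
  -- Exchange of time and lags: the summable weights g g' stay outside, while inside, for each fixed
  -- pair of lags, there remains a martingale sum with weights of modulus at most 1.
  have e1 : ∀ ω, ∑ k ∈ Finset.range T, (filterOutput e c k ω * filterOutput e c' k ω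
        - ∫ ω, filterOutput e c k ω * filterOutput e c' k ω ∂P)
      = ∑ x ∈ Finset.range (T + 1) ×ˢ Finset.range (T + 1), (g x.1 * g' x.2) *
        ∑ k ∈ Finset.range T, (c k x.1 / g x.1 * (c' k x.2 / g' x.2)) *
          lagProd P e k x.1 x.2 ω := fun ω => by
    have : ∀ k ∈ Finset.range T, filterOutput e c k ω * filterOutput e c' k ω
        - ∫ ω, filterOutput e c k ω * filterOutput e c' k ω ∂P
        = ∑ x ∈ Finset.range (T + 1) ×ˢ Finset.range (T + 1),
          c k x.1 * c' k x.2 * lagProd P e k x.1 x.2 ω := fun k hk =>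
      filterOutput_mul_sub_integral h hc hc' (by simp at hk; omega) ω
    rw [Finset.sum_congr rfl this, Finset.sum_comm]
    refine Finset.sum_congr rfl fun x _ => ?_
    rw [Finset.mul_sum]
    refine Finset.sum_congr rfl fun k _ => ?_
    have := (hg0 x.1).ne'
    have := (hg0' x.2).ne'
    field_simp
  simp only [e1]
  rw [mul_assoc]
  refine integral_weighted_sum_pow_le _ (fun x : ℕ × ℕ => g x.1 * g' x.2)
    (fun x _ => mul_pos (hg0 _) (hg0' _)) ?_ _
    (fun x _ => HasMoments.sum _ fun k _ => (hasMoments_lagProd h k _ _).const_mul _) hq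
    (by positivity) fun x _ => hM x.1 x.2 _ (fun k => ?_) (fun k hk => ?_) T
  · rw [Finset.sum_product, ← Finset.sum_mul_sum]
    exact mul_le_mul (hgs.sum_le_tsum _ fun i _ => (hg0 i).le)
      (hgs'.sum_le_tsum _ fun i _ => (hg0' i).le) (Finset.sum_nonneg fun i _ => (hg0' i).le) hG
  · rw [abs_mul, abs_div, abs_div, abs_of_pos (hg0 _), abs_of_pos (hg0' _)]
    exact mul_le_one₀ ((div_le_one (hg0 _)).2 (hg _ _)) (by have := hg0' x.2; positivity)
      ((div_le_one (hg0' _)).2 (hg' _ _))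
  · rcases hk with hk | hk
    · rw [hc.causal k _ hk]; simp
    · rw [hc'.causal k _ hk]; simp

end Filters

/-! ### Events of probability below every power of 1/k. -/

section Negligible

variable {Ω : Type*} [MeasurableSpace Ω] {P : Measure Ω}

/-- The probability of `A k` decays faster than every power of `k`. -/
def Negligible (P : Measure Ω) (A : ℕ → Set Ω) : Prop :=
  ∀ p : ℕ, (fun k => P.real (A k)) =O[atTop] fun k : ℕ => 1 / (k : ℝ) ^ p

lemma Negligible.mono [IsFiniteMeasure P] {A B : ℕ → Set Ω} (hB : Negligible P B)
    (h : ∀ᶠ k in atTop, ∀ᵐ ω ∂P, ω ∈ A k → ω ∈ B k) : Negligible P A := fun p => by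
  refine Asymptotics.IsBigO.trans (Asymptotics.IsBigO.of_bound 1 ?_) (hB p)
  filter_upwards [h] with k hk
  rw [one_mul, Real.norm_of_nonneg measureReal_nonneg, Real.norm_of_nonneg measureReal_nonneg]
  exact ENNReal.toReal_mono (measure_ne_top _ _) (measure_mono_ae hk)

lemma Negligible.union [IsFiniteMeasure P] {A B : ℕ → Set Ω} (hA : Negligible P A)
    (hB : Negligible P B) : Negligible P fun k => A k ∪ B k := fun p => by
  refine Asymptotics.IsBigO.trans (Asymptotics.IsBigO.of_bound 1 (Eventually.of_forall fun k => ?_))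
    ((hA p).add (hB p))
  rw [one_mul, Real.norm_of_nonneg measureReal_nonneg,
    Real.norm_of_nonneg (add_nonneg measureReal_nonneg measureReal_nonneg)]
  exact measureReal_union_le _ _

lemma Negligible.iUnion [IsFiniteMeasure P] {ι : Type*} [Fintype ι] {A : ι → ℕ → Set Ω}
    (hA : ∀ i, Negligible P (A i)) : Negligible P fun k => ⋃ i, A i k := fun p => by
  refine Asymptotics.IsBigO.trans (Asymptotics.IsBigO.of_bound 1 (Eventually.of_forall fun k => ?_))
    (Asymptotics.IsBigO.sum (s := Finset.univ) fun i _ => hA i p)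
  rw [one_mul, Finset.sum_apply, Real.norm_of_nonneg measureReal_nonneg,
    Real.norm_of_nonneg (Finset.sum_nonneg fun _ _ => measureReal_nonneg)]
  exact measureReal_iUnion_fintype_le _

/-- A union bound over at most 3k times l ≥ k^γ. Decay l^(-q) with γq ≥ p + 1 gives k^(-p-1) for
each, which pays for the number of terms. -/
lemma Negligible.window [IsFiniteMeasure P] {A : ℕ → Set Ω} (hA : Negligible P A) {γ : ℝ}
    (hγ : 0 < γ) : Negligible P fun k : ℕ => {ω | ∃ l : ℕ, (k : ℝ) ^ γ ≤ l ∧ l ≤ 2 * k ∧ ω ∈ A l} :=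
    fun p => by
  obtain ⟨q, hq⟩ := exists_nat_ge (((p : ℝ) + 1) / γ)
  rw [div_le_iff₀ hγ] at hq
  obtain ⟨C, hC⟩ := (hA q).bound
  obtain ⟨l₀, hl₀⟩ := eventually_atTop.1 hC
  have hlarge : Tendsto (fun k : ℕ => (k : ℝ) ^ γ) atTop atTop :=
    (tendsto_rpow_atTop hγ).comp tendsto_natCast_atTop_atTop
  refine Asymptotics.IsBigO.of_bound (3 * |C|) ?_
  filter_upwards [hlarge.eventually_ge_atTop l₀, eventually_ge_atTop 1] with k hk hk1
  have hk0 : (1 : ℝ) ≤ k := by exact_mod_cast hk1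
  have hX : 0 < (k : ℝ) ^ γ := by positivity
  rw [Real.norm_of_nonneg measureReal_nonneg, Real.norm_of_nonneg (by positivity)]
  set s := (Finset.range (2 * k + 1)).filter fun l : ℕ => (k : ℝ) ^ γ ≤ l with hs
  have hsub : {ω | ∃ l : ℕ, (k : ℝ) ^ γ ≤ l ∧ l ≤ 2 * k ∧ ω ∈ A l} ⊆ ⋃ l ∈ s, A l := by
    rintro ω ⟨l, h1, h2, h3⟩
    exact Set.mem_biUnion (by simp [hs, h1]; omega) h3
  have hcard : (s.card : ℝ) ≤ 3 * k := by
    have : s.card ≤ 2 * k + 1 := (Finset.card_filter_le _ _).trans (by simp)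
    have : s.card ≤ 3 * k := by omega
    exact_mod_cast this
  have hbound : ∀ l ∈ s, P.real (A l) ≤ |C| / (k : ℝ) ^ (p + 1) := by
    intro l hl
    rw [hs, Finset.mem_filter] at hl
    have h1 := hl₀ l (by exact_mod_cast hk.trans hl.2)
    rw [Real.norm_of_nonneg measureReal_nonneg, Real.norm_of_nonneg (by positivity)] at h1
    have hl0 : (0 : ℝ) < l := hX.trans_le hl.2
    have h2 : (k : ℝ) ^ (p + 1) ≤ (l : ℝ) ^ q := by
      calc (k : ℝ) ^ (p + 1) = (k : ℝ) ^ ((p : ℝ) + 1) := by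
            rw [← Real.rpow_natCast]; push_cast; rfl
        _ ≤ (k : ℝ) ^ (γ * q) := Real.rpow_le_rpow_of_exponent_le hk0 (by linarith)
        _ = ((k : ℝ) ^ γ) ^ q := by rw [Real.rpow_mul (by positivity), Real.rpow_natCast]
        _ ≤ (l : ℝ) ^ q := by gcongr; exact hl.2
    calc P.real (A l) ≤ C * (1 / (l : ℝ) ^ q) := h1
      _ ≤ |C| * (1 / (l : ℝ) ^ q) := by gcongr; exact le_abs_self C
      _ ≤ |C| * (1 / (k : ℝ) ^ (p + 1)) := by gcongr
      _ = _ := by ring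
  calc P.real {ω | ∃ l : ℕ, (k : ℝ) ^ γ ≤ l ∧ l ≤ 2 * k ∧ ω ∈ A l}
      ≤ P.real (⋃ l ∈ s, A l) := measureReal_mono hsub (measure_ne_top _ _)
    _ ≤ ∑ l ∈ s, P.real (A l) := measureReal_biUnion_finset_le _ _
    _ ≤ s.card • (|C| / (k : ℝ) ^ (p + 1)) := Finset.sum_le_card_nsmul _ _ _ hbound
    _ ≤ (3 * k) * (|C| / (k : ℝ) ^ (p + 1)) := by rw [nsmul_eq_mul]; gcongr
    _ = 3 * |C| * (1 / (k : ℝ) ^ p) := by rw [pow_succ]; field_simp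

/-- Markov's inequality for all moments: if all moments of `X k / k ^ a` are bounded, then `X k`
exceeds a larger power of `k` with negligible probability. -/
lemma negligible_of_moments [IsProbabilityMeasure P] {X : ℕ → Ω → ℝ}
    (hX : ∀ k, HasMoments P (X k)) {a b η : ℝ} (hab : a < b) (hη : 0 < η)
    (h : ∀ q : ℕ, 1 ≤ q → ∃ C : ℝ, ∀ k : ℕ, 1 ≤ k →
      ∫ ω, X k ω ^ (2 * q) ∂P ≤ C * ((k : ℝ) ^ a) ^ (2 * q)) :
    Negligible P fun k : ℕ => {ω | η * (k : ℝ) ^ b < |X k ω|} := fun p => by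
  -- Markov's inequality at order n = 2(q + 1) yields k^(-(b-a)n), and (b - a)q ≥ p already
  -- suffices.
  obtain ⟨q, hq⟩ := exists_nat_ge ((p : ℝ) / (b - a))
  rw [div_le_iff₀ (by linarith)] at hq
  obtain ⟨C, hC⟩ := h (q + 1) (by omega)
  refine Asymptotics.IsBigO.of_bound (|C| / η ^ (2 * (q + 1))) ?_
  filter_upwards [eventually_ge_atTop 1] with k hk1
  have hk0 : (1 : ℝ) ≤ k := by exact_mod_cast hk1
  rw [Real.norm_of_nonneg measureReal_nonneg, Real.norm_of_nonneg (by positivity)]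
  set n := 2 * (q + 1) with hn
  have hev : Even n := even_two_mul _
  have hb : 0 < (k : ℝ) ^ b := by positivity
  have ha : 0 < (k : ℝ) ^ a := by positivity
  have hmarkov := mul_meas_ge_le_integral_of_nonneg
    (ae_of_all P fun ω => hev.pow_nonneg (X k ω)) ((hX k).pow n).integrable ((η * (k : ℝ) ^ b) ^ n)
  have hsub : {ω | η * (k : ℝ) ^ b < |X k ω|} ⊆ {ω | (η * (k : ℝ) ^ b) ^ n ≤ X k ω ^ n} := by
    intro ω hω
    rw [Set.mem_ofPred_eq] at hω ⊢
    rw [← hev.pow_abs (X k ω)]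
    gcongr
  have h1 : (η * (k : ℝ) ^ b) ^ n * P.real {ω | η * (k : ℝ) ^ b < |X k ω|}
      ≤ |C| * ((k : ℝ) ^ a) ^ n := by
    calc _ ≤ (η * (k : ℝ) ^ b) ^ n * P.real {ω | (η * (k : ℝ) ^ b) ^ n ≤ X k ω ^ n} := by
          exact mul_le_mul_of_nonneg_left (measureReal_mono hsub (measure_ne_top _ _))
            (by positivity)
      _ ≤ C * ((k : ℝ) ^ a) ^ n := hmarkov.trans (hC k hk1)
      _ ≤ _ := by gcongr; exact le_abs_self C
  have h2 : (k : ℝ) ^ p * ((k : ℝ) ^ a) ^ n ≤ ((k : ℝ) ^ b) ^ n := by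
    rw [← Real.rpow_natCast ((k : ℝ) ^ a), ← Real.rpow_natCast ((k : ℝ) ^ b),
      ← Real.rpow_mul (by positivity), ← Real.rpow_mul (by positivity), ← Real.rpow_natCast,
      ← Real.rpow_add (by positivity)]
    refine Real.rpow_le_rpow_of_exponent_le hk0 ?_
    rw [hn]; push_cast
    nlinarith
  have h3 : P.real {ω | η * (k : ℝ) ^ b < |X k ω|}
      ≤ |C| * ((k : ℝ) ^ a) ^ n / (η * (k : ℝ) ^ b) ^ n := by
    rw [le_div_iff₀ (by positivity)]; linarith
  refine h3.trans ?_
  rw [mul_pow, div_mul_div_comm, mul_one, div_le_div_iff₀ (by positivity) (by positivity)]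
  calc |C| * ((k : ℝ) ^ a) ^ n * (η ^ n * (k : ℝ) ^ p)
      = |C| * η ^ n * ((k : ℝ) ^ p * ((k : ℝ) ^ a) ^ n) := by ring
    _ ≤ |C| * η ^ n * ((k : ℝ) ^ b) ^ n := by gcongr
    _ = _ := by ring

end Negligible

/-! ### The regressor as filtered noise. -/

section Data

variable {Ω : Type*} [MeasurableSpace Ω] {P : Measure Ω} {e : ℕ → Ω → ℝ} {δ : ℝ}

lemma filterOutput_eq_add {Ω : Type*} (e : ℕ → Ω → ℝ) (c : ℕ → ℕ → ℝ) (k : ℕ) (ω : Ω) :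
    filterOutput e c k ω = c k 0 + ∑ i ∈ Finset.range (k + 1), c k (i + 1) * e (k - i) ω := by
  rw [filterOutput, Finset.sum_range_succ', add_comm]
  simp [lagVar]

/-- If the mean and the second moment of a filter output at time `k` are at most `C`, then so are,
up to the noise variance, the mean coefficient and the coefficient of lag zero. -/
lemma abs_coeff_le_of_moments [IsProbabilityMeasure P] (h : IsDrivingNoise P e δ)
    (c : ℕ → ℕ → ℝ) (k : ℕ) {C : ℝ} (h1 : |∫ ω, filterOutput e c k ω ∂P| ≤ C)
    (h2 : |∫ ω, filterOutput e c k ω * filterOutput e c k ω ∂P| ≤ C) :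
    |c k 0| ≤ C ∧ |c k 1| * δ ^ 2 ≤ (C + δ ^ 2) / 2 := by
  have hm := hasMoments_filterOutput h c k
  have hterm : ∀ i, HasMoments P fun ω => c k (i + 1) * e (k - i) ω :=
    fun i => (h.hasMoments (k - i)).const_mul _
  constructor
  · have : ∫ ω, filterOutput e c k ω ∂P = c k 0 := by
      simp only [filterOutput_eq_add]
      rw [integral_add (integrable_const _) (HasMoments.sum _ fun i _ => hterm i).integrable,
        integral_finsetSum _ fun i _ => (hterm i).integrable]
      simp [integral_const_mul, h.mean_zero]
    rwa [this] at h1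
  · have hcorr : ∫ ω, filterOutput e c k ω * e k ω ∂P = c k 1 * δ ^ 2 := by
      have hterm' : ∀ i, HasMoments P fun ω => c k (i + 1) * (e (k - i) ω * e k ω) :=
        fun i => ((h.hasMoments (k - i)).mul (h.hasMoments k)).const_mul _
      simp only [filterOutput_eq_add, add_mul, Finset.sum_mul, mul_assoc]
      rw [integral_add ((h.hasMoments k).const_mul _).integrable
        (HasMoments.sum _ fun i _ => hterm' i).integrable,
        integral_finsetSum _ fun i _ => (hterm' i).integrable]
      simp only [integral_const_mul, h.mean_zero, mul_zero, zero_add]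
      rw [Finset.sum_eq_single 0]
      · simp [h.integral_sq]
      · intro i hi hi0
        rw [Finset.mem_range] at hi
        rw [h.integral_mul_of_ne (by omega), mul_zero]
      · simp
    rw [← abs_of_nonneg (sq_nonneg δ), ← abs_mul, ← hcorr, abs_of_nonneg (sq_nonneg δ)]
    refine abs_integral_le_integral_abs.trans ?_
    have he2 := ((h.hasMoments k).mul (h.hasMoments k)).integrable
    have hv2 := (hm.mul hm).integrable
    calc ∫ ω, |filterOutput e c k ω * e k ω| ∂P
        ≤ ∫ ω, (filterOutput e c k ω * filterOutput e c k ω / 2 + e k ω * e k ω / 2) ∂P := by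
          refine integral_mono (hm.mul (h.hasMoments k)).integrable.abs
            ((hv2.div_const _).add (he2.div_const _)) fun ω => ?_
          dsimp only
          rw [abs_le]
          constructor <;> nlinarith [sq_nonneg (filterOutput e c k ω + e k ω),
            sq_nonneg (filterOutput e c k ω - e k ω)]
      _ ≤ _ := by
          rw [integral_add (hv2.div_const _) (he2.div_const _), integral_div, integral_div,
            h.integral_sq]
          linarith [le_abs_self (∫ ω, filterOutput e c k ω * filterOutput e c k ω ∂P)]

/-- The hypothesis on the filters dominates lags from 1 on. Room is made here at index 0 for the
mean and at index 1 for the lag-zero coefficient; a geometric term makes the majorant positive. -/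
lemma summable_pos_extension {g : ℕ → ℝ} (hg : Summable fun i => |g i|) {A B : ℝ} (hA : 0 ≤ A)
    (hB : 0 ≤ B) : ∃ g' : ℕ → ℝ, (∀ i, 0 < g' i) ∧ Summable g' ∧ A ≤ g' 0 ∧ B ≤ g' 1 ∧
      ∀ i ≥ 1, |g i| ≤ g' (i + 1) := by
  have hs : Summable fun i : ℕ => |g i| + B * (1 / 2) ^ i + (1 / 2) ^ i :=
    (hg.add (summable_geometric_two.mul_left B)).add summable_geometric_two
  refine ⟨fun i => match i with
    | 0 => A + 1
    | i + 1 => |g i| + B * (1 / 2) ^ i + (1 / 2) ^ i, fun i => ?_, ?_, ?_, ?_, fun i _ => ?_⟩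
  · cases i <;> positivity
  · exact (summable_nat_add_iff 1).1 hs
  · dsimp only; linarith
  · have := abs_nonneg (g 0)
    dsimp only; norm_num; linarith
  · have : 0 ≤ B * (1 / 2) ^ i + (1 / 2 : ℝ) ^ i := by positivity
    dsimp only; linarith

/-- A process generated by uniformly stable filters, with bounded mean and second moment, is the
output of a stable filter. -/
lemma exists_isStableFilter [IsProbabilityMeasure P] (h : IsDrivingNoise P e δ)
    {v : ℕ → Ω → ℝ} {μ : ℕ → ℝ} {f : ℕ → ℕ → ℝ} {g : ℕ → ℝ} {C : ℝ}
    (hv : ∀ k ≥ 1, ∀ᵐ ω ∂P, v k ω = μ k + ∑ i ∈ Finset.Icc 0 k, f k i * e (k - i) ω)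
    (hg : Summable fun i => |g i|) (hfg : ∀ k ≥ 1, ∀ i ≥ 1, |f k i| ≤ |g i|)
    (h1 : ∀ k, |∫ ω, v k ω ∂P| ≤ C) (h2 : ∀ k, |∫ ω, v k ω * v k ω ∂P| ≤ C) :
    ∃ c, IsStableFilter c ∧ ∀ k ≥ 1, ∀ᵐ ω ∂P, v k ω = filterOutput e c k ω := by
  have hC : 0 ≤ C := (abs_nonneg _).trans (h1 0)
  -- If δ = 0 the noise vanishes almost surely and moments cannot control the lag-zero coefficient;
  -- the noise coefficients are then replaced by 0 without changing the output.
  set χ : ℝ := if δ = 0 then 0 else 1 with hχ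
  set c : ℕ → ℕ → ℝ := fun k i => if k = 0 then 0 else match i with
    | 0 => μ k
    | i + 1 => if i ≤ k then χ * f k i else 0 with hc
  have hvc : ∀ k ≥ 1, ∀ᵐ ω ∂P, v k ω = filterOutput e c k ω := by
    intro k hk
    have hzero : ∀ᵐ ω ∂P, ∀ l, χ * e l ω = e l ω := by
      rw [ae_all_iff]
      intro l
      by_cases hδ : δ = 0
      · have := (integral_eq_zero_iff_of_nonneg (fun ω => mul_self_nonneg (e l ω))
          ((h.hasMoments l).mul (h.hasMoments l)).integrable).1 (by rw [h.integral_sq, hδ]; simp)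
        filter_upwards [this] with ω hω
        have : e l ω = 0 := by simpa using hω
        simp [this]
      · simp [hχ, hδ]
    filter_upwards [hv k hk, hzero] with ω hω h0
    rw [hω, filterOutput_eq_add, ← Nat.range_succ_eq_Icc_zero]
    have hk0 : k ≠ 0 := by omega
    simp only [hc, hk0, if_false]
    congr 1
    refine Finset.sum_congr rfl fun i hi => ?_
    rw [if_pos (by simp at hi; omega), mul_right_comm, h0, mul_comm]
  have hcoef : ∀ k ≥ 1, |c k 0| ≤ C ∧ |c k 1| * δ ^ 2 ≤ (C + δ ^ 2) / 2 := fun k hk => by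
    refine abs_coeff_le_of_moments h c k ?_ ?_
    · rw [← integral_congr_ae (hvc k hk)]; exact h1 k
    · refine le_trans (le_of_eq ?_) (h2 k)
      congr 1
      refine integral_congr_ae ?_
      filter_upwards [hvc k hk] with ω hω
      rw [hω]
  obtain ⟨g', hg0, hgs, hgA, hgB, hgi⟩ := summable_pos_extension hg hC
    (show 0 ≤ (C + δ ^ 2) / 2 / δ ^ 2 by positivity)
  refine ⟨c, ⟨⟨g', hg0, hgs, fun k i => ?_⟩, fun k i hi => ?_⟩, hvc⟩
  · rcases Nat.eq_zero_or_pos k with rfl | hk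
    · simpa [hc] using (hg0 i).le
    match i with
    | 0 => exact (hcoef k hk).1.trans hgA
    | 1 =>
      refine le_trans ?_ hgB
      by_cases hδ : δ = 0
      · simp [hc, hχ, hδ]
      · rw [le_div_iff₀ (by positivity)]
        exact (hcoef k hk).2
    | i + 2 =>
      have hχ1 : |χ| ≤ 1 := by rw [hχ]; split_ifs <;> simp
      refine le_trans ?_ (hgi (i + 1) (by omega))
      have hk0 : k ≠ 0 := by omega
      simp only [hc, hk0, if_false]
      split_ifs
      · rw [abs_mul]
        calc |χ| * |f k (i + 1)| ≤ 1 * |f k (i + 1)| := by gcongr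
          _ ≤ _ := by rw [one_mul]; exact hfg k hk (i + 1) (by omega)
      · simp
  · match i with
    | i + 1 =>
      have : ¬ i ≤ k := by omega
      simp [hc, this]

/-- A delayed and scaled filter output, started at time `k₀`, is the output of a stable filter. -/
lemma IsStableFilter.exists_delay {Ω : Type*} (e : ℕ → Ω → ℝ) {c : ℕ → ℕ → ℝ}
    (hc : IsStableFilter c) {s k₀ : ℕ} (hs : s ≤ k₀) {a : ℝ} (ha : |a| ≤ 1) :
    ∃ c', IsStableFilter c' ∧ ∀ (k : ℕ) (ω : Ω), (k < k₀ → filterOutput e c' k ω = 0) ∧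
      (k₀ ≤ k → filterOutput e c' k ω = a * filterOutput e c (k - s) ω) := by
  obtain ⟨g, hg0, hgs, hg⟩ := hc.dominated
  have habs : ∀ k i, |a * c k i| ≤ g i := fun k i => by
    rw [abs_mul]
    calc |a| * |c k i| ≤ 1 * g i := by gcongr; exact hg k i
      _ = g i := one_mul _
  set c' : ℕ → ℕ → ℝ := fun k i => if k < k₀ then 0 else match i with
    | 0 => a * c (k - s) 0
    | i + 1 => if i < s then 0 else a * c (k - s) (i - s + 1) with hc'
  -- The majorant of the delayed filter: the mean keeps index 0, the noise coefficients move up by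
  -- s, and the value 1 fills the first indices to keep it positive.
  have hpos : ∀ i, 0 < (if i = 0 then g 0 else 0) + (if i ≤ s then 1 else g (i - s)) := by
    intro i
    have h0 : 0 ≤ if i = 0 then g 0 else 0 := by
      split_ifs
      exacts [(hg0 0).le, le_rfl]
    have h1 : 0 < if i ≤ s then 1 else g (i - s) := by
      split_ifs
      exacts [one_pos, hg0 _]
    linarith
  refine ⟨c', ⟨⟨fun i => (if i = 0 then g 0 else 0) + (if i ≤ s then 1 else g (i - s)), hpos, ?_,
    fun k i => ?_⟩, fun k i hi => ?_⟩, fun k ω => ⟨fun hk => ?_, fun hk => ?_⟩⟩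
  · refine Summable.add (summable_of_ne_finset_zero (s := {0}) fun i hi => ?_) ?_
    · simp at hi; simp [hi]
    · refine (summable_nat_add_iff (s + 1)).1 ?_
      refine ((summable_nat_add_iff 1).2 hgs).congr fun i => ?_
      rw [if_neg (by omega)]
      congr 1; omega
  · by_cases hk : k < k₀
    · simpa [hc', hk] using (hpos i).le
    match i with
    | 0 =>
      have := habs (k - s) 0
      rw [abs_mul] at this
      simp only [hc', hk, if_false, abs_mul, if_true, zero_le]
      linarith
    | i + 1 =>
      by_cases hi : i < s
      · simp [hc', hk, hi, Nat.succ_le_of_lt hi]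
      · have h1 : ¬ i + 1 ≤ s := by omega
        have h2 : i + 1 - s = i - s + 1 := by omega
        simpa [hc', hk, hi, h1, h2] using habs (k - s) (i - s + 1)
  · match i with
    | i + 1 =>
      simp only [hc']
      split_ifs
      · rfl
      · rfl
      · rw [hc.causal _ _ (by omega), mul_zero]
  · simp [filterOutput, hc', hk]
  · have hk' : ¬ k < k₀ := by omega
    rw [filterOutput_eq_add, filterOutput_eq_add]
    simp only [hc', hk', if_false]
    rw [mul_add, Finset.mul_sum, show k + 1 = s + (k - s + 1) by omega, Finset.sum_range_add,
      Finset.sum_eq_zero fun i hi => by rw [if_pos (by simpa using hi), zero_mul], zero_add]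
    congr 1
    refine Finset.sum_congr rfl fun i _ => ?_
    rw [if_neg (by omega), Nat.add_sub_cancel_left, Nat.sub_add_eq, mul_assoc]

/-- The regression vector is, up to finitely many times, the output of a bank of stable filters
driven by the noise. -/
lemma DataAssumption.exists_regressor_filters [IsProbabilityMeasure P] {m n : ℕ}
    {y u : ℤ → Ω → ℝ} {r : ℕ → ℝ} {f : Fin 4 → ℕ → ℕ → ℝ}
    (hdata : DataAssumption P m n y u r e δ f) {e' : ℕ → Ω → ℝ} (h' : IsDrivingNoise P e' δ)
    (hee' : ∀ k, e k =ᵐ[P] e' k) :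
    ∃ c : Fin (m + n) → ℕ → ℕ → ℝ, ∀ i, IsStableFilter (c i) ∧
      (∀ k ≤ m + n, ∀ ω, filterOutput e' (c i) k ω = 0) ∧
      ∀ k : ℕ, m + n < k → ∀ᵐ ω ∂P,
        regressor m n (fun t => y t ω) (fun t => u t ω) k i = filterOutput e' (c i) k ω := by
  obtain ⟨g, hg, hfg⟩ := hdata.uniformly_stable
  have hae : ∀ᵐ ω ∂P, ∀ k, e k ω = e' k ω := ae_all_iff.2 hee'
  obtain ⟨Cy, hy1, hy2⟩ := hdata.output_qs.bounded
  obtain ⟨Cu, hu1, hu2⟩ := hdata.input_qs.bounded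
  obtain ⟨cy, hcy, hycy⟩ := exists_isStableFilter h' (v := fun k : ℕ => y k)
    (μ := fun k => ∑ i ∈ Finset.Icc 1 k, f 0 k i * r (k - i)) (f := f 1) (g := g) (C := Cy)
    (fun k hk => by
      filter_upwards [hdata.output_eq k hk, hae] with ω h1 h2
      simp only [h1, h2]) hg (hfg 1) (fun k => hy1 k) (fun k => hy2 k k)
  obtain ⟨cu, hcu, hucu⟩ := exists_isStableFilter h' (v := fun k : ℕ => u k)
    (μ := fun k => ∑ i ∈ Finset.Icc 0 k, f 2 k i * r (k - i)) (f := f 3) (g := g) (C := Cu)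
    (fun k hk => by
      filter_upwards [hdata.input_eq k hk, hae] with ω h1 h2
      simp only [h1, h2]) hg (hfg 3) (fun k => hu1 k) (fun k => hu2 k k)
  have hentry : ∀ i : Fin (m + n), ∃ c, IsStableFilter c ∧
      (∀ k ≤ m + n, ∀ ω, filterOutput e' c k ω = 0) ∧
      ∀ k : ℕ, m + n < k → ∀ᵐ ω ∂P,
        regressor m n (fun t => y t ω) (fun t => u t ω) k i = filterOutput e' c k ω := by
    refine Fin.addCases (fun i => ?_) fun j => ?_
    · obtain ⟨c, hc, hck⟩ := hcy.exists_delay e' (s := i + 1) (k₀ := m + n + 1) (by omega)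
        (a := -1) (by simp)
      refine ⟨c, hc, fun k hk ω => (hck k ω).1 (by omega), fun k hk => ?_⟩
      filter_upwards [hycy (k - (i + 1)) (by omega)] with ω hω
      rw [(hck k ω).2 hk, ← hω, regressor, Fin.append_left, neg_one_mul]
      congr 3; omega
    · obtain ⟨c, hc, hck⟩ := hcu.exists_delay e' (s := j + 1) (k₀ := m + n + 1) (by omega)
        (a := 1) (by simp)
      refine ⟨c, hc, fun k hk ω => (hck k ω).1 (by omega), fun k hk => ?_⟩
      filter_upwards [hucu (k - (j + 1)) (by omega)] with ω hω
      rw [(hck k ω).2 hk, ← hω, regressor, Fin.append_right, one_mul]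
      congr 2; omega
  choose c hc using hentry
  exact ⟨c, hc⟩

lemma IsGaussianNoise.hasMoments {d : ℕ → Ω → ℝ} {v : NNReal} (hd : IsGaussianNoise P d v)
    {k : ℕ} (hk : 1 ≤ k) : HasMoments P (d k) := fun p hp => by
  have hX := hd.law k hk
  have h1 := memLp_id_gaussianReal' (μ := 0) (v := v) p hp
  rw [← hX.map_eq] at h1
  exact (memLp_map_measure_iff aestronglyMeasurable_id hX.aemeasurable).1 h1

lemma IsGaussianNoise.integral_pow {d : ℕ → Ω → ℝ} {v : NNReal} (hd : IsGaussianNoise P d v)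
    {k : ℕ} (hk : 1 ≤ k) (q : ℕ) :
    ∫ ω, d k ω ^ q ∂P = ∫ x, x ^ q ∂(gaussianReal 0 v) :=
  (hd.law k hk).integral_comp (f := fun x : ℝ => x ^ q) (by fun_prop)

/-- The equation error at the true parameter vector is the noise. -/
lemma IsArxSystem.residual_eq {m n : ℕ} {a : Fin m → ℝ} {b : Fin n → ℝ} {y u : ℤ → Ω → ℝ}
    {d : ℕ → Ω → ℝ} (hsys : IsArxSystem P a b y u d) :
    ∀ᵐ ω ∂P, ∀ k : ℕ, 1 ≤ k →
      y k ω - regressor m n (fun t => y t ω) (fun t => u t ω) k ⬝ᵥ Fin.append a b = d k ω := by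
  rw [ae_all_iff]
  intro k
  by_cases hk : 1 ≤ k
  · filter_upwards [hsys.equation k hk] with ω hω _
    rw [dotProduct, Fin.sum_univ_add]
    simp only [regressor, Fin.append_left, Fin.append_right, neg_mul, Finset.sum_neg_distrib]
    simp only [mul_comm (y _ ω), mul_comm (u _ ω)]
    linarith
  · exact ae_of_all _ fun ω h => absurd h hk

end Data

/-! ### Linear growth of the information matrix. -/

section Excitation

variable {Ω : Type*} [MeasurableSpace Ω] {P : Measure Ω} {N : ℕ}

lemma dotProduct_vecMulVec_mulVec (v w : Fin N → ℝ) :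
    v ⬝ᵥ (vecMulVec w w *ᵥ v) = (w ⬝ᵥ v) ^ 2 := by
  rw [vecMulVec_mulVec, op_smul_eq_smul, dotProduct_smul, smul_eq_mul, dotProduct_comm v w, sq]

lemma dotProduct_infoMatrix_mulVec (P₀ : Matrix (Fin N) (Fin N) ℝ) (φ : ℕ → Fin N → ℝ) (k : ℕ)
    (v : Fin N → ℝ) : v ⬝ᵥ (infoMatrix P₀ φ k *ᵥ v)
      = v ⬝ᵥ (P₀⁻¹ *ᵥ v) + ∑ j ∈ Finset.range k, (φ (j + 1) ⬝ᵥ v) ^ 2 := by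
  induction k with
  | zero => simp [infoMatrix]
  | succ k ih =>
    rw [infoMatrix_succ, add_mulVec, dotProduct_add, ih, dotProduct_vecMulVec_mulVec,
      Finset.sum_range_succ, add_assoc]

/-- The constant is the minimum of the form on the compact Euclidean sphere v · v = 1; the norm of
`Fin N → ℝ` is the sup norm, so the sphere is written with the dot product. -/
lemma exists_pos_mul_dotProduct_le {M : Matrix (Fin N) (Fin N) ℝ} (hM : M.PosDef) :
    ∃ c : ℝ, 0 < c ∧ ∀ v, c * (v ⬝ᵥ v) ≤ v ⬝ᵥ (M *ᵥ v) := by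
  rcases Nat.eq_zero_or_pos N with rfl | hN
  · exact ⟨1, one_pos, fun v => by simp⟩
  have hdot : ∀ v : Fin N → ℝ, v ⬝ᵥ v = 0 → v = 0 := fun v h => dotProduct_self_eq_zero.1 h
  have hdot0 : ∀ v : Fin N → ℝ, 0 ≤ v ⬝ᵥ v := fun v =>
    Finset.sum_nonneg fun i _ => mul_self_nonneg (v i)
  have hcont : Continuous fun v : Fin N → ℝ => v ⬝ᵥ v := by
    simp only [dotProduct]; fun_prop
  have hcontM : Continuous fun v : Fin N → ℝ => v ⬝ᵥ (M *ᵥ v) := by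
    simp only [dotProduct, mulVec]; fun_prop
  have hK : IsCompact {v : Fin N → ℝ | v ⬝ᵥ v = 1} := by
    refine Metric.isCompact_of_isClosed_isBounded (isClosed_eq hcont continuous_const) ?_
    refine (Metric.isBounded_closedBall (x := (0 : Fin N → ℝ)) (r := 1)).subset fun v hv => ?_
    rw [mem_closedBall_zero_iff, pi_norm_le_iff_of_nonneg zero_le_one]
    intro i
    have h1 := sq_le_dotProduct_self v i
    rw [show v ⬝ᵥ v = 1 from hv] at h1
    exact abs_le_of_sq_le_sq (by simpa using h1) zero_le_one
  have hne : {v : Fin N → ℝ | v ⬝ᵥ v = 1}.Nonempty := ⟨Pi.single ⟨0, hN⟩ 1, by simp⟩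
  obtain ⟨w, hw, hmin⟩ := hK.exists_isMinOn hne hcontM.continuousOn
  have hw1 : w ⬝ᵥ w = 1 := hw
  have hw0 : w ≠ 0 := by rintro rfl; simp at hw1
  refine ⟨w ⬝ᵥ (M *ᵥ w), by simpa using hM.dotProduct_mulVec_pos hw0, fun v => ?_⟩
  rcases (hdot0 v).eq_or_lt with h | h
  · rw [← h, hdot v h.symm]; simp
  set s := √(v ⬝ᵥ v) with hs
  have hs0 : 0 < s := Real.sqrt_pos.2 h
  have hss : s * s = v ⬝ᵥ v := Real.mul_self_sqrt h.le
  have hmem : (s⁻¹ • v) ∈ {v : Fin N → ℝ | v ⬝ᵥ v = 1} := by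
    change (s⁻¹ • v) ⬝ᵥ (s⁻¹ • v) = 1
    rw [smul_dotProduct, dotProduct_smul, ← hss]
    simp only [smul_eq_mul]
    field_simp
  have h1 := hmin hmem
  simp only [Set.mem_ofPred_eq, mulVec_smul, smul_dotProduct, dotProduct_smul, smul_eq_mul] at h1
  rw [← hss]
  calc w ⬝ᵥ (M *ᵥ w) * (s * s) ≤ (s⁻¹ * (s⁻¹ * (v ⬝ᵥ (M *ᵥ v)))) * (s * s) := by gcongr
    _ = _ := by field_simp

/-- A perturbation of a positive definite form by entries of size `η` costs at most `N η`. -/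
lemma posDef_form_perturbation_le {M S : Matrix (Fin N) (Fin N) ℝ} {c η : ℝ}
    (hM : ∀ v, c * (v ⬝ᵥ v) ≤ v ⬝ᵥ (M *ᵥ v)) (hS : ∀ i j, |S i j - M i j| ≤ η)
    (v : Fin N → ℝ) : (c - N * η) * (v ⬝ᵥ v) ≤ v ⬝ᵥ (S *ᵥ v) := by
  have h1 : v ⬝ᵥ (S *ᵥ v) = v ⬝ᵥ (M *ᵥ v) + ∑ i, ∑ j, v i * (S i j - M i j) * v j := by
    rw [← sub_eq_iff_eq_add', ← dotProduct_sub, ← sub_mulVec]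
    simp only [dotProduct, mulVec, Finset.mul_sum, Matrix.sub_apply]
    exact Finset.sum_congr rfl fun i _ => Finset.sum_congr rfl fun j _ => by ring
  have h2 : ∑ i, ∑ j, -(η * (|v i| * |v j|)) ≤ ∑ i, ∑ j, v i * (S i j - M i j) * v j := by
    refine Finset.sum_le_sum fun i _ => Finset.sum_le_sum fun j _ => ?_
    refine neg_le_of_abs_le ?_
    rw [abs_mul, abs_mul]
    calc |v i| * |S i j - M i j| * |v j| ≤ |v i| * η * |v j| := by
          gcongr; exact hS i j
      _ = _ := by ring
  have h3 : ∑ i, ∑ j, -(η * (|v i| * |v j|)) = -(η * (∑ i, |v i|) ^ 2) := by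
    rw [sq, Finset.sum_mul_sum]
    simp only [Finset.sum_neg_distrib, Finset.mul_sum]
  rcases isEmpty_or_nonempty (Fin N) with h | ⟨⟨i₀⟩⟩
  · simp [dotProduct]
  have hη0 : 0 ≤ η := (abs_nonneg _).trans (hS i₀ i₀)
  have h4 : (∑ i, |v i|) ^ 2 ≤ N * (v ⬝ᵥ v) := by
    have := sq_sum_le_card_mul_sum_sq (s := Finset.univ) (f := fun i => |v i|)
    simpa [dotProduct, ← sq] using this
  have h5 : η * (∑ i, |v i|) ^ 2 ≤ η * (N * (v ⬝ᵥ v)) := by gcongr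
  have h6 := hM v
  rw [h3] at h2
  rw [h1]
  linarith

variable {e : ℕ → Ω → ℝ} {δ : ℝ}

lemma negligible_sum_filterOutput_mul [IsProbabilityMeasure P] (he : ∀ k, Measurable (e k))
    (h : IsDrivingNoise P e δ) {c c' : ℕ → ℕ → ℝ} (hc : IsStableFilter c)
    (hc' : IsStableFilter c') {η : ℝ} (hη : 0 < η) :
    Negligible P fun T : ℕ => {ω | η * T <
      |∑ k ∈ Finset.range (T + 1), (filterOutput e c k ω * filterOutput e c' k ω
        - ∫ ω, filterOutput e c k ω * filterOutput e c' k ω ∂P)|} := by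
  have := negligible_of_moments (P := P) (a := 1 / 2) (b := 1) (η := η) (X := fun T ω =>
      ∑ k ∈ Finset.range (T + 1), (filterOutput e c k ω * filterOutput e c' k ω
        - ∫ ω, filterOutput e c k ω * filterOutput e c' k ω ∂P))
    (fun T => HasMoments.sum _ fun k _ => ((hasMoments_filterOutput h c k).mul
      (hasMoments_filterOutput h c' k)).sub (HasMoments.const _)) (by norm_num) hη fun q hq => ?_
  · simpa using this
  obtain ⟨C, hC0, hC⟩ := integral_sum_filterOutput_mul_pow_le he h hc hc' hq
  -- The sum has k + 1 ≤ 2k terms.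
  refine ⟨C * 2 ^ q, fun k hk => (hC (k + 1)).trans ?_⟩
  have hk0 : (1 : ℝ) ≤ k := by exact_mod_cast hk
  have h2 : ((k : ℝ) ^ (1 / 2 : ℝ)) ^ (2 * q) = (k : ℝ) ^ q := by
    rw [pow_mul, ← Real.sqrt_eq_rpow, Real.sq_sqrt (by positivity)]
  rw [h2, mul_assoc, ← mul_pow]
  push_cast
  gcongr
  linarith

/-- The averaged expectations of the regressor products and of their filter versions have the same
limits. -/
lemma eventually_sum_integral_filterOutput_mul [IsProbabilityMeasure P] {N₀ : ℕ}
    {φ φ' : ℕ → Ω → ℝ} {c c' : ℕ → ℕ → ℝ} {L : ℝ}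
    (hL : Tendsto (fun K : ℕ => (1 / (K : ℝ)) * ∑ l ∈ Finset.Icc 1 K, ∫ ω, φ l ω * φ' l ω ∂P)
      atTop (𝓝 L))
    (h0 : ∀ k ≤ N₀, ∀ ω, filterOutput e c k ω = 0)
    (h1 : ∀ k : ℕ, N₀ < k → ∀ᵐ ω ∂P, φ k ω = filterOutput e c k ω)
    (h1' : ∀ k : ℕ, N₀ < k → ∀ᵐ ω ∂P, φ' k ω = filterOutput e c' k ω) {η : ℝ} (hη : 0 < η) :
    ∀ᶠ T : ℕ in atTop, |∑ k ∈ Finset.range (T + 1),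
      ∫ ω, filterOutput e c k ω * filterOutput e c' k ω ∂P - T * L| ≤ η * T := by
  -- The contribution of the start-up times, which the averaging removes.
  set B := ∑ l ∈ Finset.Icc 1 N₀, ∫ ω, φ l ω * φ' l ω ∂P with hB
  have hsum : ∀ T, N₀ ≤ T → ∑ k ∈ Finset.range (T + 1),
      ∫ ω, filterOutput e c k ω * filterOutput e c' k ω ∂P
      = ∑ l ∈ Finset.Icc 1 T, ∫ ω, φ l ω * φ' l ω ∂P - B := by
    intro T hT
    induction T, hT using Nat.le_induction with
    | base =>
      rw [← hB, sub_self]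
      refine Finset.sum_eq_zero fun k hk => ?_
      simp [h0 k (by simp at hk; omega)]
    | succ T hT ih =>
      rw [Finset.sum_range_succ, ih, Finset.sum_Icc_succ_top (by omega), add_sub_right_comm]
      congr 1
      refine integral_congr_ae ?_
      filter_upwards [h1 (T + 1) (by omega), h1' (T + 1) (by omega)] with ω e1 e2
      rw [e1, e2]
  have hB0 : Tendsto (fun K : ℕ => (1 / (K : ℝ)) * B) atTop (𝓝 0) := by
    simpa using tendsto_one_div_atTop_nhds_zero_nat.mul_const B
  have hlim := hL.sub hB0
  rw [sub_zero] at hlim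
  have := hlim.eventually (Metric.closedBall_mem_nhds L hη)
  filter_upwards [this, eventually_ge_atTop N₀, eventually_ge_atTop 1] with T hT hTN hT1
  have hT0 : (0 : ℝ) < T := by exact_mod_cast hT1
  rw [hsum T hTN]
  rw [Real.dist_eq, ← mul_sub] at hT
  set s := ∑ l ∈ Finset.Icc 1 T, ∫ ω, φ l ω * φ' l ω ∂P
  have e1 : s - B - T * L = (1 / T * (s - B) - L) * T := by field_simp
  rw [e1, abs_mul, abs_of_pos hT0]
  gcongr

/-- Persistent excitation: with overwhelming probability, the information matrix grows at least
linearly. -/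
lemma negligible_infoMatrix_lt [IsProbabilityMeasure P] (he : ∀ k, Measurable (e k))
    (h : IsDrivingNoise P e δ) {N₀ : ℕ} {φ : Ω → ℕ → Fin N → ℝ} {c : Fin N → ℕ → ℕ → ℝ}
    (hc : ∀ i, IsStableFilter (c i)) (h0 : ∀ i, ∀ k ≤ N₀, ∀ ω, filterOutput e (c i) k ω = 0)
    (h1 : ∀ i, ∀ k : ℕ, N₀ < k → ∀ᵐ ω ∂P, φ ω k i = filterOutput e (c i) k ω)
    {M : Matrix (Fin N) (Fin N) ℝ} (hM : M.PosDef)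
    (hlim : ∀ i j, Tendsto (fun K : ℕ => (1 / (K : ℝ)) *
      ∑ l ∈ Finset.Icc 1 K, ∫ ω, φ ω l i * φ ω l j ∂P) atTop (𝓝 (M i j)))
    {P₀ : Matrix (Fin N) (Fin N) ℝ} (hP₀ : P₀.PosDef) :
    ∃ κ : ℝ, 0 < κ ∧ Negligible P fun k : ℕ =>
      {ω | ¬ ∀ v, κ * k * (v ⬝ᵥ v) ≤ v ⬝ᵥ (infoMatrix P₀ (φ ω) k *ᵥ v)} := by
  obtain ⟨κ, hκ, hMκ⟩ := exists_pos_mul_dotProduct_le hM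
  -- Fluctuation and bias of the mean each cost η per entry; together they lower the form by at most
  -- 2Nη ≤ κ/2.
  set η : ℝ := κ / (4 * (N + 1)) with hη
  have hη0 : 0 < η := by positivity
  refine ⟨κ / 2, by positivity, ?_⟩
  have hneg := Negligible.iUnion (P := P) (ι := Fin N × Fin N) fun x =>
    negligible_sum_filterOutput_mul he h (hc x.1) (hc x.2) hη0
  refine hneg.mono ?_
  have hmean : ∀ᶠ T : ℕ in atTop, ∀ x : Fin N × Fin N, |∑ k ∈ Finset.range (T + 1),
      ∫ ω, filterOutput e (c x.1) k ω * filterOutput e (c x.2) k ω ∂P - T * M x.1 x.2| ≤ η * T :=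
    eventually_all.2 fun x => eventually_sum_integral_filterOutput_mul
      (φ := fun k ω => φ ω k x.1) (φ' := fun k ω => φ ω k x.2) (hlim x.1 x.2) (h0 x.1) (h1 x.1)
      (h1 x.2) hη0
  have hae : ∀ᵐ ω ∂P, ∀ i, ∀ k : ℕ, N₀ < k → φ ω k i = filterOutput e (c i) k ω := by
    rw [ae_all_iff]; intro i
    rw [ae_all_iff]; intro k
    by_cases hk : N₀ < k
    · filter_upwards [h1 i k hk] with ω hω _ using hω
    · exact ae_of_all _ fun ω h => absurd h hk
  filter_upwards [hmean, eventually_ge_atTop 1] with T hT hT1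
  have hT0 : (0 : ℝ) < T := by exact_mod_cast hT1
  filter_upwards [hae] with ω hω hbad
  by_contra hgood
  apply hbad
  intro v
  simp only [Set.mem_iUnion, Set.mem_ofPred_eq, not_exists, not_lt] at hgood
  set S : Matrix (Fin N) (Fin N) ℝ := (1 / (T : ℝ)) • ∑ k ∈ Finset.range (T + 1),
    vecMulVec (fun i => filterOutput e (c i) k ω) (fun i => filterOutput e (c i) k ω) with hS
  have hSM : ∀ i j, |S i j - M i j| ≤ 2 * η := by
    intro i j
    have g1 := hgood (i, j)
    have g2 := hT (i, j)
    rw [Finset.sum_sub_distrib] at g1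
    dsimp only at g1 g2
    have e1 : S i j - M i j = (∑ k ∈ Finset.range (T + 1),
        filterOutput e (c i) k ω * filterOutput e (c j) k ω - T * M i j) / T := by
      rw [hS, Matrix.smul_apply, Matrix.sum_apply]
      simp only [vecMulVec_apply, smul_eq_mul]
      field_simp
    rw [e1, abs_div, abs_of_pos hT0, div_le_iff₀ hT0]
    rw [abs_le] at g1 g2 ⊢
    constructor <;> linarith [g1.1, g1.2, g2.1, g2.2]
  have hquad := posDef_form_perturbation_le hMκ hSM v
  have hvv : 0 ≤ v ⬝ᵥ v := Finset.sum_nonneg fun i _ => mul_self_nonneg (v i)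
  have hNη : (N : ℝ) * (2 * η) ≤ κ / 2 := by
    rw [hη]
    have : (N : ℝ) / (N + 1) ≤ 1 := by rw [div_le_one (by positivity)]; linarith
    calc (N : ℝ) * (2 * (κ / (4 * (N + 1)))) = N / (N + 1) * (κ / 2) := by field_simp; ring
      _ ≤ 1 * (κ / 2) := by gcongr
      _ = _ := one_mul _
  have hS2 : v ⬝ᵥ (S *ᵥ v) = (1 / (T : ℝ)) *
      ∑ k ∈ Finset.range (T + 1), ((fun i => filterOutput e (c i) k ω) ⬝ᵥ v) ^ 2 := by
    rw [hS, smul_mulVec, sum_mulVec, dotProduct_smul, dotProduct_sum, smul_eq_mul]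
    simp only [dotProduct_vecMulVec_mulVec]
  -- Replacing regressors by filter outputs only discards squares, since the outputs vanish up to
  -- time N₀.
  have hle : ∑ k ∈ Finset.range (T + 1), ((fun i => filterOutput e (c i) k ω) ⬝ᵥ v) ^ 2
      ≤ ∑ j ∈ Finset.range T, (φ ω (j + 1) ⬝ᵥ v) ^ 2 := by
    rw [Finset.sum_range_succ']
    have : (fun i => filterOutput e (c i) 0 ω) = 0 := by
      ext i; exact h0 i 0 (Nat.zero_le _) ω
    rw [this, zero_dotProduct, zero_pow two_ne_zero, add_zero]
    refine Finset.sum_le_sum fun k _ => ?_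
    by_cases hk : N₀ < k + 1
    · have : φ ω (k + 1) = fun i => filterOutput e (c i) (k + 1) ω := by
        ext i; exact hω i (k + 1) hk
      rw [this]
    · have : (fun i => filterOutput e (c i) (k + 1) ω) = 0 := by
        ext i; exact h0 i _ (by omega) ω
      rw [this, zero_dotProduct, zero_pow two_ne_zero]
      positivity
  rw [dotProduct_infoMatrix_mulVec]
  have hP := dotProduct_mulVec_nonneg_of_posDef hP₀.inv v
  have e2 : ∑ k ∈ Finset.range (T + 1), ((fun i => filterOutput e (c i) k ω) ⬝ᵥ v) ^ 2
      = T * (v ⬝ᵥ (S *ᵥ v)) := by rw [hS2]; field_simp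
  have e3 : κ / 2 * (v ⬝ᵥ v) ≤ v ⬝ᵥ (S *ᵥ v) := by
    refine le_trans ?_ hquad
    gcongr
    linarith
  have e4 := mul_le_mul_of_nonneg_left e3 hT0.le
  linarith

end Excitation

/-! ### The good event for the local estimates, and the theorem. -/

section Main

variable {Ω : Type*} [MeasurableSpace Ω] {P : Measure Ω}

/-- The output of a stable filter exceeds a positive power of time with negligible probability. -/
lemma negligible_lt_abs_filterOutput [IsProbabilityMeasure P] {e : ℕ → Ω → ℝ} {δ : ℝ}
    (h : IsDrivingNoise P e δ) {c : ℕ → ℕ → ℝ} (hc : IsStableFilter c) {ε : ℝ} (hε : 0 < ε) :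
    Negligible P fun k : ℕ => {ω | (k : ℝ) ^ ε < |filterOutput e c (k + 1) ω|} := by
  have := negligible_of_moments (P := P) (X := fun k => filterOutput e c (k + 1))
    (fun k => hasMoments_filterOutput h c (k + 1)) hε one_pos fun q hq => by
      obtain ⟨C, -, hC⟩ := integral_filterOutput_pow_le h hc hq
      exact ⟨C, fun k _ => by simpa using hC (k + 1)⟩
  simpa using this

lemma IsGaussianNoise.negligible_lt_abs [IsProbabilityMeasure P] {d : ℕ → Ω → ℝ} {v : NNReal}
    (hd : IsGaussianNoise P d v) {ε : ℝ} (hε : 0 < ε) :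
    Negligible P fun k : ℕ => {ω | (k : ℝ) ^ ε < |d (k + 1) ω|} := by
  have := negligible_of_moments (P := P) (X := fun k => d (k + 1))
    (fun k => hd.hasMoments (by omega)) hε one_pos fun q hq =>
      ⟨_, fun k _ => by
        rw [hd.integral_pow (by omega), Real.rpow_zero, one_pow, mul_one]⟩
  simpa using this

/-- By Jensen with unit weights, the 2q-th moment of the sum is at most k^(2q) times the 4q-th
moment of one Gaussian variable. The loss k^ε is affordable. -/
lemma IsGaussianNoise.negligible_lt_sum_sq [IsProbabilityMeasure P] {d : ℕ → Ω → ℝ} {v : NNReal}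
    (hd : IsGaussianNoise P d v) {ε : ℝ} (hε : 0 < ε) :
    Negligible P fun k : ℕ =>
      {ω | (k : ℝ) ^ (1 + ε) < ∑ j ∈ Finset.range k, d (j + 1) ω ^ 2} := by
  have := negligible_of_moments (P := P) (a := 1) (b := 1 + ε) (η := 1)
    (X := fun k ω => ∑ j ∈ Finset.range k, d (j + 1) ω ^ 2)
    (fun k => HasMoments.sum _ fun j _ => (hd.hasMoments (by omega)).pow 2) (by linarith) one_pos
    fun q hq => by
      refine ⟨∫ x, x ^ (2 * (2 * q)) ∂(gaussianReal 0 v), fun k hk => ?_⟩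
      have h1 := integral_weighted_sum_pow_le (P := P) (Finset.range k) (fun _ => 1)
        (fun _ _ => one_pos) (A := k) (by simp) (fun j ω => d (j + 1) ω ^ 2)
        (fun j _ => (hd.hasMoments (by omega)).pow 2) hq
        (M := ∫ x, x ^ (2 * (2 * q)) ∂(gaussianReal 0 v))
        (integral_nonneg fun x => (even_two_mul _).pow_nonneg x) fun j _ => by
          simp only [← pow_mul]
          rw [hd.integral_pow (by omega)]
      simp only [one_mul] at h1
      rw [Real.rpow_one]
      exact h1.trans_eq (mul_comm _ _)
  refine this.mono (Eventually.of_forall fun k => ae_of_all _ fun ω hω => ?_)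
  simp only [Set.mem_ofPred_eq, one_mul] at hω ⊢
  exact hω.trans_le (le_abs_self _)

/-- With overwhelming probability, the local estimates grow at most linearly, and their increments
are of smaller order than `k ^ (-α)`. -/
lemma negligible_localEstimate_increment [IsProbabilityMeasure P]
    {m n : ℕ} {a : Fin m → ℝ} {b : Fin n → ℝ}
    {y u : ℤ → Ω → ℝ} {d : ℕ → Ω → ℝ} (hsys : IsArxSystem P a b y u d)
    {r : ℕ → ℝ} {e : ℕ → Ω → ℝ} {δe : ℝ} {f : Fin 4 → ℕ → ℕ → ℝ}
    (hdata : DataAssumption P m n y u r e δe f)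
    {vd : NNReal} (hnoise : IsGaussianNoise P d vd)
    {P₀ : Matrix (Fin (m + n)) (Fin (m + n)) ℝ} (hP₀ : P₀.PosDef) (θ₀ : Fin (m + n) → ℝ)
    {α η : ℝ} (hα0 : 0 < α) (hα : α < 1) (hη : 0 < η) :
    Negligible P fun l : ℕ => {ω | ¬ ∀ i, |localEstimate P₀ θ₀ y u ω l i| ≤ l ∧
      |localEstimate P₀ θ₀ y u ω (l + 1) i - localEstimate P₀ θ₀ y u ω l i|
        ≤ η / (l : ℝ) ^ α} := by
  obtain ⟨e', he', h', hee'⟩ := hdata.noise.exists_measurable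
  obtain ⟨c, hc⟩ := hdata.exists_regressor_filters h' hee'
  obtain ⟨M, hlim, hM⟩ := hdata.persistent_excitation
  set φ : Ω → ℕ → Fin (m + n) → ℝ :=
    fun ω k => regressor m n (fun t => y t ω) (fun t => u t ω) k with hφ
  obtain ⟨κ, hκ, hinfo⟩ := negligible_infoMatrix_lt (φ := φ) he' h' (fun i => (hc i).1)
    (fun i => (hc i).2.1) (fun i => (hc i).2.2) hM hlim hP₀
  -- Increments are of order k^(3ε-1), and here 3ε - 1 = -α - ε.
  set ε : ℝ := (1 - α) / 4 with hε
  have hε0 : 0 < ε := by rw [hε]; linarith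
  have hreg := Negligible.iUnion (P := P) fun i =>
    negligible_lt_abs_filterOutput h' (hc i).1 hε0
  have hbad := (hinfo.union hreg).union
    ((hnoise.negligible_lt_abs hε0).union (hnoise.negligible_lt_sum_sq hε0))
  refine hbad.mono ?_
  set θ : Fin (m + n) → ℝ := Fin.append a b with hθ
  set V₀ : ℝ := (θ₀ - θ) ⬝ᵥ (P₀⁻¹ *ᵥ (θ₀ - θ)) with hV₀
  have hlarge : Tendsto (fun k : ℕ => (k : ℝ) ^ ε) atTop atTop :=
    (tendsto_rpow_atTop hε0).comp tendsto_natCast_atTop_atTop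
  have hfilter : ∀ k : ℕ, m + n < k + 1 → ∀ᵐ ω ∂P, ∀ i,
      φ ω (k + 1) i = filterOutput e' (c i) (k + 1) ω :=
    fun k hk => ae_all_iff.2 fun i => by
      exact_mod_cast (hc i).2.2 (k + 1) hk
  filter_upwards [eventually_ge_atTop (m + n), eventually_ge_atTop 1,
    hlarge.eventually_ge_atTop ((|V₀| + 1) / κ),
    eventually_mul_rpow_le (show ε < 1 by rw [hε]; linarith) ((∑ i, |θ i|) + 1) one_pos,
    eventually_mul_rpow_le (show 3 * ε - 1 < -α by rw [hε]; linarith)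
      ((1 + (m + n : ℕ)) * (m + n : ℕ) / κ) hη]
    with k hkN hk1 hkV hkθ hkη
  have hk0 : (1 : ℝ) ≤ k := by exact_mod_cast hk1
  filter_upwards [hfilter k (by omega), hsys.residual_eq] with ω hφω hres hω
  by_contra hgood
  apply hω
  simp only [Set.mem_union, Set.mem_iUnion, Set.mem_ofPred_eq, not_or, not_exists, not_not,
    not_lt] at hgood
  obtain ⟨⟨hg1, hg2⟩, hg3, hg4⟩ := hgood
  have hA1 : 1 ≤ (k : ℝ) ^ ε := Real.one_le_rpow hk0 hε0.le
  have hsum : ∑ j ∈ Finset.range k, (y ((j + 1 : ℕ) : ℤ) ω - φ ω (j + 1) ⬝ᵥ θ) ^ 2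
      = ∑ j ∈ Finset.range k, d (j + 1) ω ^ 2 :=
    Finset.sum_congr rfl fun j _ => by rw [hφ, hθ, hres (j + 1) (by omega)]
  -- The second factor k^ε absorbs the initial energy and the constant 1/κ, so the estimation error
  -- is at most k^ε.
  have hE : V₀ + ∑ j ∈ Finset.range k, (y ((j + 1 : ℕ) : ℤ) ω - φ ω (j + 1) ⬝ᵥ θ) ^ 2
      ≤ κ * k * ((k : ℝ) ^ ε) ^ 2 := by
    rw [hsum]
    rw [div_le_iff₀ hκ] at hkV
    have e1 : (k : ℝ) ^ (1 + ε) = k * (k : ℝ) ^ ε := by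
      rw [Real.rpow_add (by linarith), Real.rpow_one]
    rw [e1] at hg4
    have hx : 1 ≤ (k : ℝ) * (k : ℝ) ^ ε := by nlinarith
    calc _ ≤ |V₀| * ((k : ℝ) * (k : ℝ) ^ ε) + (k : ℝ) * (k : ℝ) ^ ε := by
          have := le_abs_self V₀
          have := le_mul_of_one_le_right (abs_nonneg V₀) hx
          linarith
      _ = ((k : ℝ) * (k : ℝ) ^ ε) * (|V₀| + 1) := by ring
      _ ≤ ((k : ℝ) * (k : ℝ) ^ ε) * ((k : ℝ) ^ ε * κ) := by gcongr
      _ = _ := by ring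
  intro i
  obtain ⟨hb1, hb2⟩ := rls_step_bounds hP₀ θ₀ θ (fun k : ℕ => y k ω) (φ ω) k
    (c := κ * k) (A := (k : ℝ) ^ ε) (B := (k : ℝ) ^ ε) (by positivity) (by positivity)
    (by positivity) hg1 (fun i => by rw [hφω i]; exact hg2 i)
    (by
      have := hres (k + 1) (by omega)
      rw [hφ, hθ]
      rw [this]
      exact hg3) hE i
  constructor
  · have h1 : |θ i| ≤ ∑ i, |θ i| :=
      Finset.single_le_sum (f := fun i => |θ i|) (fun _ _ => abs_nonneg _) (Finset.mem_univ i)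
    have h2 := abs_sub_abs_le_abs_sub (rlsEstimate P₀ θ₀ (fun k : ℕ => y k ω) (φ ω) k i) (θ i)
    have h3 := le_mul_of_one_le_right (Finset.sum_nonneg fun i (_ : i ∈ Finset.univ) =>
      abs_nonneg (θ i)) hA1
    rw [Real.rpow_one, one_mul, add_mul, one_mul] at hkθ
    change |rlsEstimate P₀ θ₀ (fun k : ℕ => y k ω) (φ ω) k i| ≤ k
    linarith
  · refine hb2.trans ?_
    rw [Real.rpow_neg (by positivity), ← div_eq_mul_inv] at hkη
    refine le_trans ?_ hkη
    have e1 : (k : ℝ) ^ (3 * ε - 1) = (k : ℝ) ^ ε * (k : ℝ) ^ ε * (k : ℝ) ^ ε / k := by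
      rw [Real.rpow_sub_one (by positivity), ← Real.rpow_add (by positivity),
        ← Real.rpow_add (by positivity)]
      ring_nf
    rw [e1]
    set x := (k : ℝ) ^ ε
    set N : ℝ := ((m + n : ℕ) : ℝ) with hN
    have hNr : 0 ≤ N := Nat.cast_nonneg _
    have h1 : x + N * (x * x) ≤ (1 + N) * (x * x) := by nlinarith
    calc (x + N * (x * x)) * (N * x / (κ * k)) ≤ ((1 + N) * (x * x)) * (N * x / (κ * k)) := by
          gcongr
      _ = _ := by field_simp

end Main

end ArxOneBit

theorem theorem1 {Ω : Type*} [MeasurableSpace Ω] (P : Measure Ω) [IsProbabilityMeasure P]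
    (m n : ℕ) (hmn : 0 < m + n) (a : Fin m → ℝ) (b : Fin n → ℝ)
    (y u : ℤ → Ω → ℝ) (d : ℕ → Ω → ℝ)
    (hsys : ArxOneBit.IsArxSystem P a b y u d)
    (r : ℕ → ℝ) (e : ℕ → Ω → ℝ) (δe : ℝ) (f : Fin 4 → ℕ → ℕ → ℝ)
    (hdata : ArxOneBit.DataAssumption P m n y u r e δe f)
    (hstable : ArxOneBit.IsStable a)
    (vd : NNReal) (hnoise : ArxOneBit.IsGaussianNoise P d vd)
    (P₀ : Matrix (Fin (m + n)) (Fin (m + n)) ℝ) (hP₀ : P₀.PosDef)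
    (θRLS₀ θ₀ : Fin (m + n) → ℝ)
    (α : ℝ) (hα : 1 / 2 < α) (hα' : α < 1)
    (β : ℕ → ℝ) (βlow βup : ℝ) (hβlow : 0 < βlow)
    (hβ : ∀ k ≥ 1, βlow ≤ β k ∧ β k ≤ βup)
    (p : ℕ) (hp : 0 < p) :
    (fun k : ℕ => P.real {ω | (βup + 2 * βlow / 3) / (k : ℝ) ^ α <
        |ArxOneBit.trackingGap α β θ₀ (ArxOneBit.localEstimate P₀ θRLS₀ y u ω) k|})
      =O[atTop] (fun k : ℕ => 1 / (k : ℝ) ^ p) := by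
  have hN : (0 : ℝ) < ((m + n : ℕ) : ℝ) := by exact_mod_cast hmn
  have hstep := ArxOneBit.negligible_localEstimate_increment hsys hdata hnoise hP₀ θRLS₀
    (by linarith) hα'
    -- Per-step drift allowance: over N steps it amounts to a third of the smallest update.
    (η := βlow / (3 * ((m + n : ℕ) : ℝ))) (by positivity)
  have hwindow := hstep.window (show 0 < (1 - α) / 2 by linarith)
  refine hwindow.mono ?_ p
  filter_upwards [ArxOneBit.eventually_abs_trackingGap_le β θ₀ hmn hβlow hβ
    (show 0 < α by linarith) hα'] with k hk
  refine ae_of_all _ fun ω hω => ?_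
  by_contra hgood
  refine absurd (hk _ fun l hl1 hl2 => ?_) (not_le.2 hω)
  by_contra hbad
  exact hgood ⟨l, hl1, hl2, hbad⟩
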